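/- There is an absolute constant $C>0$ such that the following holds for all integers $k\ge 1$, $\ell\ge 1$, $s\ge 0$ and all $\varepsilon\in(0,1)$. In an $\ell$-bit, $s$-coin simultaneous-message-passing protocol with $n$ users, user $i$ holds a sample $X_i\in[k]$, the $X_i$ being i.i.d. from an unknown distribution $\mathbf p$ on $[k]$. All users and the server see a public string $U$ uniform on $\{0,1\}^s$, and user $i$ also has a private random variable $U_i$; the variables $U,U_1,\dots,U_n,X_1,\dots,X_n$ are independent. User $i$ selects, as a function of $(U,U_i)$, a randomized channel $W_i\colon[k]\to\{0,1\}^\ell$ and sends $Y_i=W_i(X_i)$. From $U$ and $Y_1,\dots,Y_n$ the (possibly randomized) server outputs $0$ (accept) or $1$ (reject). The protocol performs $(k,\varepsilon)$-identity testing for the reference distribution $\mathbf q$ if the output is $0$ with probability $>11/12$ when $\mathbf p=\mathbf q$, and is $1$ with probability $>11/12$ whenever $\mathrm{d}_{\mathrm{TV}}(\mathbf p,\mathbf q)>\varepsilon$. Then there is an integer $n\ge 0$ (depending only on $k,\ell,s,\varepsilon$) with $$ n\;\le\; C\cdot\frac{\sqrt{k}}{\varepsilon^2}\sqrt{\frac{k}{2^{\ell}}\vee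 1}\,\sqrt{\frac{k}{2^{s+\ell}}\vee 1} $$ such that for every (known) reference distribution $\mathbf q$ on $[k]$ there is an $\ell$-bit, $s$-coin protocol with $n$ users performing $(k,\varepsilon)$-identity testing for $\mathbf q$. Moreover, the protocol can be chosen so that the users and the server use only the first $\min(\max(\lfloor\log_2 k\rfloor-\ell,0),s)$ of the $s$ public bits. In particular, when $\ell+s\le\log_2 k$, the bound reads $$ n\;\le\; C\cdot\frac{k}{2^{\ell/2}\varepsilon^2}\sqrt{\frac{k}{2^{s+\ell}}}. $$ -/

import Mathlib

namespace DistTesting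

noncomputable section

/-- Total variation distance `sup_S (p(S) - q(S))` between distributions on `[k]`. -/
def tvDist {k : ℕ} (p q : PMF (Fin k)) : ℝ :=
  ⨆ S : Finset (Fin k), (∑ x ∈ S, (p x).toReal - ∑ x ∈ S, (q x).toReal)

/-- The joint law of independent random variables with laws `μ 0, …, μ (n-1)` on a finite set. -/
def productLaw {n : ℕ} {β : Type} [Fintype β] (μ : Fin n → PMF β) : PMF (Fin n → β) :=
  PMF.ofFintype (fun y => ∏ i, μ i (y i)) (by
    classical
    have h := Finset.prod_univ_sum (fun _ : Fin n => (Finset.univ : Finset β))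
      (fun i y => μ i y)
    rw [Fintype.piFinset_univ] at h
    rw [← h]
    refine Finset.prod_eq_one fun i _ => ?_
    rw [← tsum_fintype (L := .unconditional β), (μ i).tsum_coe])

/-- A string of `m` bits. -/
abbrev Bits (m : ℕ) : Type := Fin m → Bool

/-- A randomized channel `W : [k] → {0,1}^ℓ`; `W x y` is the probability of sending the message
`y` on input `x`. -/
abbrev Channel (k ℓ : ℕ) : Type := Fin k → PMF (Bits ℓ)

/-- An `s`-coin simultaneous-message-passing protocol with `n` users holding samples in `[k]` and
sending `ℓ`-bit messages. User `i` picks a channel as a function of the public string `u` and of a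
private seed with law `seedLaw i`; the server sees the public string and the messages, but not the
private seeds, and outputs (possibly with its own randomness) a verdict in `{0,1}`, where `0` means
accept and `1` means reject. -/
structure SMPProtocol (k ℓ s n : ℕ) where
  Seed : Fin n → Type
  seedLaw : (i : Fin n) → PMF (Seed i)
  select : (i : Fin n) → Bits s → Seed i → Channel k ℓ
  server : Bits s → (Fin n → Bits ℓ) → PMF (Fin 2)

namespace SMPProtocol

variable {k ℓ s n : ℕ}

/-- The law of the message of user `i`, for the public string `u`, when the sample of the user is
drawn from `p` independently of the private seed. -/
def messageLaw (P : SMPProtocol k ℓ s n) (p : PMF (Fin k)) (u : Bits s) (i : Fin n) :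
    PMF (Bits ℓ) :=
  p.bind fun x => (P.seedLaw i).bind fun c => P.select i u c x

/-- The law of the verdict when the `n` samples are i.i.d. from `p`, the public string is uniform
on `{0,1}^s`, and samples, private seeds and public string are jointly independent; given the
public string the messages are thus independent. -/
def verdictLaw (P : SMPProtocol k ℓ s n) (p : PMF (Fin k)) : PMF (Fin 2) :=
  (PMF.uniformOfFintype (Bits s)).bind fun u =>
    (productLaw (P.messageLaw p u)).bind fun y => P.server u y

/-- The protocol performs identity testing against the reference distribution `q` with distance
parameter `ε` and failure probability `δ`. -/
def IsIdentityTest (P : SMPProtocol k ℓ s n) (q : PMF (Fin k)) (ε δ : ℝ) : Prop :=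
  ∀ p : PMF (Fin k),
    (p = q → 1 - δ < (P.verdictLaw p 0).toReal) ∧
    (ε < tvDist p q → 1 - δ < (P.verdictLaw p 1).toReal)

/-- Neither the users nor the server look at public bits other than the first `t`. -/
def UsesOnlyFirst (P : SMPProtocol k ℓ s n) (t : ℕ) : Prop :=
  ∀ u v : Bits s, (∀ j : Fin s, (j : ℕ) < t → u j = v j) →
    (∀ i, P.select i u = P.select i v) ∧ P.server u = P.server v

end SMPProtocol

end

end DistTesting

namespace DistTesting

/-! Flattening: each `x` is split into `⌊k q(x)⌋ + 1` equal copies. There are at most `2k` copies,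
each of `q`-mass at most `1/k`, and a distribution at distance more than `ε` from `q` differs from
it on the copies by at least `ε²/(2k)` in squared `ℓ²` norm (`le_sum_copyDiff_sq`). The copies are
placed in a grid of `2^(ℓ-1)` bins with `m ≈ 4k/2^ℓ + 1` cells each. A user picks a random copy of
its sample, sends the bin with `ℓ-1` bits, and spends the last bit on a sign attached to the
position inside the bin. The sign vector depends on the public string and on the user's group.

Fully random signs would preserve the `ℓ²` distance up to a constant, but only `2^t` public strings
are available. The derandomization `exists_spread_signs` shows that `2^t` blocks of `g` sign vectors
suffice once `g 2^t` is a large multiple of `m`: every real vector keeps its share of energy in all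
but `1/48` of the blocks. A block may have bounded size, so no single block need be good for all
vectors. The union bound therefore runs over lattice points and over sets `T` of blocks, so that
concentration acts on all `|T| g` rows at once. An operator bound on sign vectors absorbs the
rounding error. `spread_direct_sum` carries the statement to all bins simultaneously.

For each public string, the server correlates the centred message counts of two independent batches
of `g` groups of `N` users. The mean is `N² D`, where `D` is the total squared `ℓ²` distance between
message laws. `prodEx_crossStat_sq_le` bounds the variance, and Chebyshev's inequality separates `D
= 0` from `D ≥ gε²/(400k)` once `N` is of order `√(g m k)/(g ε²)`. With `g` of order `m/2^t`, the
total `2gN` is of order `m √(k/2^t)/ε²`, which is the claimed bound. -/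

/-! ### Moments and exponential moments of Rademacher sums. -/

/-- The sign `±1` encoded by a bit. -/
def sgn (b : Bool) : ℝ := if b then 1 else -1

lemma sgn_sq (b : Bool) : sgn b ^ 2 = 1 := by cases b <;> simp [sgn]

/-- The inner product of a vector of signs with a real vector. -/
def signDot {n : ℕ} (a : Fin n → Bool) (x : Fin n → ℝ) : ℝ := ∑ i, sgn (a i) * x i

lemma signDot_add {n : ℕ} (a : Fin n → Bool) (x y : Fin n → ℝ) :
    signDot a (fun i => x i + y i) = signDot a x + signDot a y := by
  simp [signDot, mul_add, Finset.sum_add_distrib]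

lemma signDot_smul {n : ℕ} (a : Fin n → Bool) (c : ℝ) (x : Fin n → ℝ) :
    signDot a (fun i => c * x i) = c * signDot a x := by
  simp only [signDot, Finset.mul_sum]
  exact Finset.sum_congr rfl fun i _ => by ring

lemma signDot_cons {n : ℕ} (b : Bool) (a : Fin n → Bool) (x : Fin (n + 1) → ℝ) :
    signDot (Fin.cons b a) x = sgn b * x 0 + signDot a (fun i => x i.succ) := by
  simp [signDot, Fin.sum_univ_succ]

lemma sum_bool_cons {n : ℕ} (F : (Fin (n + 1) → Bool) → ℝ) :
    ∑ a, F a = ∑ a : Fin n → Bool, (F (Fin.cons true a) + F (Fin.cons false a)) := by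
  rw [← (Fin.consEquiv fun _ : Fin (n + 1) => Bool).sum_comp, Fintype.sum_prod_type,
    Finset.sum_comm]
  refine Finset.sum_congr rfl fun a _ => ?_
  simp [Fin.consEquiv]

lemma sum_signDot_sq {n : ℕ} (x : Fin n → ℝ) :
    ∑ a, signDot a x ^ 2 = 2 ^ n * ∑ i, x i ^ 2 := by
  induction n with
  | zero => simp [signDot]
  | succ n ih =>
    rw [sum_bool_cons, Fin.sum_univ_succ]
    have h : ∀ a : Fin n → Bool, signDot (Fin.cons true a) x ^ 2 + signDot (Fin.cons false a) x ^ 2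
        = 2 * x 0 ^ 2 + 2 * signDot a (fun i => x i.succ) ^ 2 := by
      intro a; simp only [signDot_cons, sgn]; simp; ring
    simp only [h, Finset.sum_add_distrib, ← Finset.mul_sum, ih]
    simp
    ring

/-- Averaging over the first sign kills the odd powers, so the induction only needs the exact second
moment. The constant `3` is the Gaussian one. -/
lemma sum_signDot_pow_four_le {n : ℕ} (x : Fin n → ℝ) :
    ∑ a, signDot a x ^ 4 ≤ 3 * 2 ^ n * (∑ i, x i ^ 2) ^ 2 := by
  induction n with
  | zero => simp [signDot]
  | succ n ih =>
    rw [sum_bool_cons, Fin.sum_univ_succ]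
    have h : ∀ a : Fin n → Bool, signDot (Fin.cons true a) x ^ 4 + signDot (Fin.cons false a) x ^ 4
        = 2 * x 0 ^ 4 + (12 * x 0 ^ 2) * signDot a (fun i => x i.succ) ^ 2
          + 2 * signDot a (fun i => x i.succ) ^ 4 := by
      intro a; simp only [signDot_cons, sgn]; simp; ring
    simp only [h, Finset.sum_add_distrib, ← Finset.mul_sum, sum_signDot_sq]
    have := ih fun i => x i.succ
    simp only [Finset.sum_const, Finset.card_univ, Fintype.card_fun, Fintype.card_bool,
      Fintype.card_fin, nsmul_eq_mul, Nat.cast_pow, Nat.cast_ofNat]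
    have h4 : 0 ≤ (2 : ℝ) ^ n * x 0 ^ 4 := by positivity
    rw [pow_succ (2 : ℝ) n]
    nlinarith

/-- The lower tail of the square of a Rademacher sum, through its Laplace transform. -/
lemma sum_exp_neg_signDot_sq_le {n : ℕ} (x : Fin n → ℝ) (hx : 0 < ∑ i, x i ^ 2) :
    ∑ a, Real.exp (-(signDot a x ^ 2 / (3 * ∑ i, x i ^ 2))) ≤ 5 / 6 * 2 ^ n := by
  set q := ∑ i, x i ^ 2 with hq
  -- With `y = λ S²/q`, the second and fourth moments give `1 - λ + 3λ²/2`. The choice `λ = 1/3`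
  -- minimizes this, with value `5/6`.
  have key : ∀ y : ℝ, 0 ≤ y → Real.exp (-y) ≤ 1 - y + y ^ 2 / 2 := by
    intro y hy
    have h1 := Real.quadratic_le_exp_of_nonneg hy
    rw [Real.exp_neg, inv_le_iff_one_le_mul₀ (Real.exp_pos y)]
    have h2 : 0 < 1 - y + y ^ 2 / 2 := by nlinarith [sq_nonneg (y - 1)]
    calc (1 : ℝ) ≤ (1 - y + y ^ 2 / 2) * (1 + y + y ^ 2 / 2) := by nlinarith [sq_nonneg (y ^ 2)]
      _ ≤ _ := by gcongr
  calc ∑ a, Real.exp (-(signDot a x ^ 2 / (3 * q)))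
      ≤ ∑ a, (1 - signDot a x ^ 2 / (3 * q) + (signDot a x ^ 2 / (3 * q)) ^ 2 / 2) :=
        Finset.sum_le_sum fun a _ => key _ (by positivity)
    _ = 2 ^ n - (∑ a, signDot a x ^ 2) / (3 * q) + (∑ a, signDot a x ^ 4) / (18 * q ^ 2) := by
        rw [Finset.sum_add_distrib, Finset.sum_sub_distrib, Finset.sum_div, Finset.sum_div]
        congr 1
        · simp
        · exact Finset.sum_congr rfl fun a _ => by field_simp; ring
    _ ≤ 2 ^ n - 2 ^ n * q / (3 * q) + 3 * 2 ^ n * q ^ 2 / (18 * q ^ 2) := by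
        rw [sum_signDot_sq]
        gcongr
        exact sum_signDot_pow_four_le x
    _ = 5 / 6 * 2 ^ n := by field_simp; norm_num

/-- Integrating out one sign produces a `cosh`, and `cosh y ≤ exp (y²/2)` turns the scale `m` into
`m - 1`. The free scale `m` is what makes the induction close. -/
lemma sum_exp_signDot_sq_le_aux {n : ℕ} (v : Fin n → ℝ) (hv : ∀ i, v i ^ 2 = 1) (m : ℝ)
    (hm : (n : ℝ) < m) :
    ∑ a, Real.exp (signDot a v ^ 2 / (2 * m)) ≤ 2 ^ n * Real.exp (n / (2 * (m - n))) := by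
  induction n generalizing m with
  | zero => simp [signDot]
  | succ n ih =>
    push_cast at hm ⊢
    have hn : (0 : ℝ) ≤ n := n.cast_nonneg
    have hm1 : 0 < m - 1 := by linarith
    have hm0 : 0 < m := by linarith
    have hmn : 0 < m - (n + 1) := by linarith
    rw [sum_bool_cons]
    have h : ∀ a : Fin n → Bool, Real.exp (signDot (Fin.cons true a) v ^ 2 / (2 * m))
        + Real.exp (signDot (Fin.cons false a) v ^ 2 / (2 * m))
        ≤ 2 * Real.exp (1 / (2 * m))
          * Real.exp (signDot a (fun i => v i.succ) ^ 2 / (2 * (m - 1))) := by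
      intro a
      simp only [signDot_cons, sgn]
      set S := signDot a (fun i => v i.succ)
      have e1 : ((if True then (1 : ℝ) else -1) * v 0 + S) ^ 2 / (2 * m)
          = 1 / (2 * m) + S ^ 2 / (2 * m) + v 0 * S / m := by
        simp only [if_true]
        field_simp
        linear_combination hv 0
      have e2 : ((if False then (1 : ℝ) else -1) * v 0 + S) ^ 2 / (2 * m)
          = 1 / (2 * m) + S ^ 2 / (2 * m) + -(v 0 * S / m) := by
        simp only [if_false]
        field_simp
        linear_combination hv 0
      simp only [Bool.false_eq_true] at *
      rw [e1, e2, Real.exp_add, Real.exp_add _ (-_), ← mul_add]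
      have hc := Real.cosh_le_exp_half_sq (v 0 * S / m)
      rw [Real.cosh_eq] at hc
      have e3 : (v 0 * S / m) ^ 2 / 2 = S ^ 2 / (2 * m ^ 2) := by
        rw [div_pow, mul_pow, hv 0]; field_simp
      rw [e3] at hc
      -- The gap `1/(m-1) - 1/m = 1/(m(m-1))` is at least `1/m²`.
      have hS : S ^ 2 / (2 * m) + S ^ 2 / (2 * m ^ 2) ≤ S ^ 2 / (2 * (m - 1)) := by
        have : 1 / (2 * m) + 1 / (2 * m ^ 2) ≤ 1 / (2 * (m - 1)) := by
          rw [div_add_div _ _ (by positivity) (by positivity),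
            div_le_div_iff₀ (by positivity) (by positivity)]
          nlinarith
        calc _ = S ^ 2 * (1 / (2 * m) + 1 / (2 * m ^ 2)) := by ring
          _ ≤ S ^ 2 * (1 / (2 * (m - 1))) := by gcongr
          _ = _ := by ring
      calc _ ≤ Real.exp (1 / (2 * m) + S ^ 2 / (2 * m)) * (2 * Real.exp (S ^ 2 / (2 * m ^ 2))) := by
            gcongr; linarith
        _ = 2 * Real.exp (1 / (2 * m)) * Real.exp (S ^ 2 / (2 * m) + S ^ 2 / (2 * m ^ 2)) := by
            rw [Real.exp_add, Real.exp_add (S ^ 2 / (2 * m))]; ring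
        _ ≤ _ := by gcongr
    calc _ ≤ ∑ a : Fin n → Bool, 2 * Real.exp (1 / (2 * m))
          * Real.exp (signDot a (fun i => v i.succ) ^ 2 / (2 * (m - 1))) :=
          Finset.sum_le_sum fun a _ => h a
      _ ≤ 2 * Real.exp (1 / (2 * m)) * (2 ^ n * Real.exp (n / (2 * ((m - 1) - n)))) := by
          rw [← Finset.mul_sum]
          gcongr
          exact ih _ (fun i => hv _) _ (by linarith)
      _ ≤ 2 * Real.exp (1 / (2 * (m - (n + 1)))) * (2 ^ n * Real.exp (n / (2 * (m - (n + 1))))) := by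
          have : m - 1 - n = m - (n + 1) := by ring
          rw [this]
          gcongr
          linarith
      _ = _ := by
          rw [add_div, Real.exp_add, pow_succ]; ring

/-- The square of a sum of `n` signs is sub-exponential at scale `n`. -/
lemma sum_exp_signDot_sq_le {n : ℕ} (hn : 0 < n) (v : Fin n → ℝ) (hv : ∀ i, v i ^ 2 = 1) :
    ∑ a, Real.exp (signDot a v ^ 2 / (4 * n)) ≤ 2 ^ n * Real.exp (1 / 2) := by
  have hn' : (0 : ℝ) < n := by exact_mod_cast hn
  have h := sum_exp_signDot_sq_le_aux v hv (2 * n) (by linarith)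
  have e : (n : ℝ) / (2 * (2 * n - n)) = 1 / 2 := by
    rw [show (2 : ℝ) * (2 * n - n) = 2 * n by ring]; field_simp
  rw [e] at h
  convert h using 4
  ring


/-! ### Counting sign matrices with atypical images. -/

lemma card_filter_le_sum_of_one_le {α : Type*} (s : Finset α) (P : α → Prop) [DecidablePred P]
    (F : α → ℝ) (h0 : ∀ a ∈ s, 0 ≤ F a) (h1 : ∀ a ∈ s, P a → 1 ≤ F a) :
    ((s.filter P).card : ℝ) ≤ ∑ a ∈ s, F a := by
  rw [Finset.card_filter, Nat.cast_sum]
  refine Finset.sum_le_sum fun a ha => ?_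
  split_ifs with h
  · simpa using h1 a ha h
  · simpa using h0 a ha

/-- The exponential Markov inequality for counting functions on a finite product. -/
lemma card_le_exp_mul_prod_sum {R α : Type*} [Fintype R] [DecidableEq R] [Fintype α]
    (F : R → α → ℝ) (θ : ℝ) [DecidablePred fun A : R → α => θ ≤ ∑ r, F r (A r)] :
    ((Finset.univ.filter fun A : R → α => θ ≤ ∑ r, F r (A r)).card : ℝ)
      ≤ Real.exp (-θ) * ∏ r, ∑ a, Real.exp (F r a) := by
  rw [Fintype.prod_sum, Finset.mul_sum]
  refine card_filter_le_sum_of_one_le _ _ _ (fun A _ => by positivity) fun A _ hA => ?_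
  rw [← Real.exp_sum, ← Real.exp_add]
  exact Real.one_le_exp (by linarith)

section SignMatrices

variable {R : Type*} [Fintype R] [DecidableEq R] {n : ℕ}

/-- Per row, the threshold costs `exp (-5/2)` and the exponential moment returns `exp (1/2)`. The
resulting `exp (-2)` per row beats a union bound over the `2^n` sign vectors when there are at least
`n` rows. -/
lemma card_large_image_le (hn : 0 < n) (v : Fin n → ℝ) (hv : ∀ i, v i ^ 2 = 1) :
    ((Finset.univ.filter fun A : R → Fin n → Bool =>
        10 * (Fintype.card R : ℝ) * n ≤ ∑ r, signDot (A r) v ^ 2).card : ℝ)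
      ≤ (2 ^ n) ^ Fintype.card R * Real.exp (-(2 * Fintype.card R)) := by
  classical
  have hn' : (0 : ℝ) < n := by exact_mod_cast hn
  have h := card_le_exp_mul_prod_sum (R := R)
    (fun _ (a : Fin n → Bool) => signDot a v ^ 2 / (4 * n)) (5 / 2 * Fintype.card R)
  refine le_trans (Nat.cast_le.mpr (Finset.card_le_card fun A hA => ?_)) (h.trans ?_)
  · rw [Finset.mem_filter] at hA ⊢
    refine ⟨hA.1, ?_⟩
    rw [← Finset.sum_div, le_div_iff₀ (by positivity)]
    linarith [hA.2]
  · calc _ ≤ Real.exp (-(5 / 2 * Fintype.card R)) * ∏ _r : R, (2 ^ n * Real.exp (1 / 2)) := by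
          gcongr
          exact sum_exp_signDot_sq_le hn v hv
      _ = (2 ^ n) ^ Fintype.card R * Real.exp (-(2 * Fintype.card R)) := by
          rw [Finset.prod_const, Finset.card_univ, mul_pow, ← Real.exp_nat_mul, mul_left_comm,
            ← Real.exp_add]
          ring_nf

lemma exp_tenth_le : Real.exp (1 / 10) ≤ 72 / 65 := by
  refine le_of_pow_le_pow_left₀ (n := 10) (by norm_num) (by norm_num) ?_
  rw [← Real.exp_nat_mul]
  norm_num
  linarith [Real.exp_one_lt_d9]

/-- Only rows in `T` are weighted in the exponential Markov bound. Each contributes `exp (1/10) ·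
5/6 ≤ 12/13`. -/
lemma card_small_image_le (x : Fin n → ℝ) (hx : 0 < ∑ i, x i ^ 2) (T : Finset R) :
    ((Finset.univ.filter fun A : R → Fin n → Bool =>
        ∑ r ∈ T, signDot (A r) x ^ 2 ≤ 3 / 10 * (T.card : ℝ) * ∑ i, x i ^ 2).card : ℝ)
      ≤ (2 ^ n) ^ Fintype.card R * (12 / 13) ^ T.card := by
  classical
  set q := ∑ i, x i ^ 2 with hq
  have h := card_le_exp_mul_prod_sum (R := R)
    (fun r (a : Fin n → Bool) => if r ∈ T then -(signDot a x ^ 2 / (3 * q)) else 0)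
    (-(1 / 10 * T.card))
  refine le_trans (Nat.cast_le.mpr (Finset.card_le_card fun A hA => ?_)) (h.trans ?_)
  · rw [Finset.mem_filter] at hA ⊢
    refine ⟨hA.1, ?_⟩
    rw [Finset.sum_ite_mem, Finset.univ_inter, Finset.sum_neg_distrib, neg_le_neg_iff,
      ← Finset.sum_div, div_le_iff₀ (by positivity)]
    linarith [hA.2]
  · calc _ ≤ Real.exp (1 / 10 * T.card) * ∏ r : R, ((if r ∈ T then 5 / 6 else 1) * 2 ^ n) := by
          rw [neg_neg]
          gcongr with r
          split_ifs with hr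
          · exact sum_exp_neg_signDot_sq_le x hx
          · simp
      _ = (2 ^ n) ^ Fintype.card R * (Real.exp (1 / 10) * (5 / 6)) ^ T.card := by
          rw [Finset.prod_mul_distrib, Finset.prod_const, Finset.card_univ, Finset.prod_ite_mem,
            Finset.univ_inter, Finset.prod_const, mul_pow, ← Real.exp_nat_mul]
          ring_nf
      _ ≤ _ := by
          gcongr
          linarith [exp_tenth_le]

end SignMatrices

/-! ### Lattice points in an `ℓ¹` ball, and extension from sign vectors to the cube. -/

lemma sum_Icc_half_pow_natAbs (K : ℕ) :
    ∑ z ∈ Finset.Icc (-(K : ℤ)) K, (1 / 2 : ℝ) ^ z.natAbs = 3 - 2 * (1 / 2) ^ K := by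
  induction K with
  | zero => norm_num
  | succ K ih =>
    have h : Finset.Icc (-((K + 1 : ℕ) : ℤ)) (K + 1 : ℕ)
        = insert (-((K : ℤ) + 1)) (insert ((K : ℤ) + 1) (Finset.Icc (-(K : ℤ)) K)) := by
      ext z
      simp only [Finset.mem_Icc, Finset.mem_insert]
      omega
    rw [h, Finset.sum_insert, Finset.sum_insert, ih]
    · have e1 : (-((K : ℤ) + 1)).natAbs = K + 1 := by omega
      have e2 : ((K : ℤ) + 1).natAbs = K + 1 := by omega
      rw [e1, e2, pow_succ]; ring
    · simp
    · simp only [Finset.mem_Icc, Finset.mem_insert]; omega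

/-- The integer vectors of `ℓ¹` norm at most `K`. -/
noncomputable def intBall (n K : ℕ) : Finset (Fin n → ℤ) :=
  (Fintype.piFinset fun _ => Finset.Icc (-(K : ℤ)) K).filter fun z => ∑ i, (z i).natAbs ≤ K

lemma mem_intBall {n K : ℕ} {z : Fin n → ℤ} : z ∈ intBall n K ↔ ∑ i, (z i).natAbs ≤ K := by
  rw [intBall, Finset.mem_filter, and_iff_right_iff_imp]
  intro h
  rw [Fintype.mem_piFinset]
  intro i
  have := Finset.single_le_sum (f := fun i => (z i).natAbs) (fun _ _ => Nat.zero_le _)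
    (Finset.mem_univ i)
  rw [Finset.mem_Icc]
  omega

/-- Rankin's trick: each point is weighted by `2^(K - ‖z‖₁) ≥ 1`, and the weights factor over
coordinates. -/
lemma card_intBall_le (n K : ℕ) : ((intBall n K).card : ℝ) ≤ 2 ^ K * 3 ^ n := by
  calc ((intBall n K).card : ℝ)
      ≤ ∑ z ∈ Fintype.piFinset fun _ : Fin n => Finset.Icc (-(K : ℤ)) K,
          2 ^ K * ∏ i, (1 / 2 : ℝ) ^ (z i).natAbs := by
        refine card_filter_le_sum_of_one_le _ _ _ (fun z _ => by positivity) fun z _ hz => ?_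
        rw [Finset.prod_pow_eq_pow_sum]
        calc (1 : ℝ) = 2 ^ K * (1 / 2) ^ K := by rw [← mul_pow]; norm_num
          _ ≤ _ := mul_le_mul_of_nonneg_left
            (pow_le_pow_of_le_one (by norm_num) (by norm_num) hz) (by positivity)
    _ = 2 ^ K * (∑ z ∈ Finset.Icc (-(K : ℤ)) K, (1 / 2 : ℝ) ^ z.natAbs) ^ n := by
        rw [← Finset.mul_sum, ← Finset.prod_univ_sum (fun _ : Fin n => Finset.Icc (-(K : ℤ)) K)
          (fun _ z => (1 / 2 : ℝ) ^ z.natAbs)]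
        simp
    _ ≤ 2 ^ K * 3 ^ n := by
        have : (0 : ℝ) < (1 / 2) ^ K := by positivity
        gcongr
        rw [sum_Icc_half_pow_natAbs]; linarith

/-- A quadratic bound on sign vectors extends to the cube by convexity. -/
lemma sum_signDot_sq_le_of_abs_le {R : Type*} [Fintype R] {n : ℕ} (A : R → Fin n → Bool) {B : ℝ}
    (h : ∀ v : Fin n → ℝ, (∀ i, v i ^ 2 = 1) → ∑ r, signDot (A r) v ^ 2 ≤ B)
    {δ : ℝ} (hδ : 0 < δ) (e : Fin n → ℝ) (he : ∀ i, |e i| ≤ δ) :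
    ∑ r, signDot (A r) e ^ 2 ≤ δ ^ 2 * B := by
  have hconv : ConvexOn ℝ Set.univ fun x : Fin n → ℝ => ∑ r, signDot (A r) x ^ 2 := by
    refine ⟨convex_univ, fun x _ y _ a b ha hb hab => ?_⟩
    simp only [smul_eq_mul, Finset.mul_sum, ← Finset.sum_add_distrib]
    refine Finset.sum_le_sum fun r _ => ?_
    have e1 : signDot (A r) (a • x + b • y) = a * signDot (A r) x + b * signDot (A r) y := by
      rw [← signDot_smul, ← signDot_smul, ← signDot_add]; rfl
    rw [e1]
    have hb' : b = 1 - a := by linarith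
    subst hb'
    nlinarith [mul_nonneg (mul_nonneg ha hb) (sq_nonneg (signDot (A r) x - signDot (A r) y))]
  have hmem : (fun i => δ⁻¹ * e i) ∈
      convexHull ℝ (Set.univ.pi fun _ : Fin n => ({-1, 1} : Set ℝ)) := by
    rw [convexHull_pi]
    intro i _
    rw [convexHull_pair, segment_eq_Icc (by norm_num)]
    have := abs_le.mp (he i)
    change δ⁻¹ * e i ∈ Set.Icc (-1) 1
    rw [inv_mul_eq_div, Set.mem_Icc, le_div_iff₀ hδ, div_le_iff₀ hδ]
    constructor <;> linarith
  obtain ⟨v, hv, hle⟩ := hconv.exists_ge_of_mem_convexHull (Set.subset_univ _) hmem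
  have hB := h v fun i => by
    rcases hv i (Set.mem_univ i) with h1 | h1
    · rw [h1]; norm_num
    · rw [Set.mem_singleton_iff.mp h1]; norm_num
  have e2 : ∀ r, signDot (A r) e = δ * signDot (A r) fun i => δ⁻¹ * e i := by
    intro r
    rw [← signDot_smul]
    congr 1
    funext i
    field_simp
  simp only [e2, mul_pow, ← Finset.mul_sum]
  have := hle.trans hB
  gcongr

/-! ### Existence of spread sign families by the probabilistic method. -/

/-- The numerical constant of the union bound in `exists_spread_signs`. -/
def spreadConst : ℕ := 48 * (9 * 30004)

section Spread

variable {U : Type} [Fintype U] [DecidableEq U] {n g : ℕ}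

/-- Some family of sign vectors has bounded operator norm on sign vectors, and no lattice point of
moderate size has a small image under a constant fraction of its blocks. -/
lemma exists_good_signs (hn : 0 < n) (hU : Fintype.card U ≤ n)
    (hg : spreadConst * n ≤ g * Fintype.card U) :
    ∃ A : U × Fin g → Fin n → Bool,
      (∀ v : Fin n → ℝ, (∀ i, v i ^ 2 = 1) →
        ∑ r, signDot (A r) v ^ 2 ≤ 10 * (Fintype.card (U × Fin g) : ℝ) * n) ∧
      ∀ z ∈ intBall n (30000 * n), z ≠ 0 → ∀ T : Finset U, Fintype.card U < 48 * T.card →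
        3 / 10 * ((T.card : ℝ) * g) * ∑ i, (z i : ℝ) ^ 2
          < ∑ r ∈ T ×ˢ (Finset.univ : Finset (Fin g)), signDot (A r) (fun i => (z i : ℝ)) ^ 2 := by
  classical
  set m := Fintype.card (U × Fin g) with hm
  have hm' : m = Fintype.card U * g := by simp [hm]
  set G := intBall n (30000 * n)
  let bad1 (v : Fin n → Bool) : Finset (U × Fin g → Fin n → Bool) :=
    Finset.univ.filter fun A => 10 * (m : ℝ) * n ≤ ∑ r, signDot (A r) (fun i => sgn (v i)) ^ 2
  let bad2 (z : Fin n → ℤ) (T : Finset U) : Finset (U × Fin g → Fin n → Bool) :=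
    Finset.univ.filter fun A =>
      ∑ r ∈ T ×ˢ (Finset.univ : Finset (Fin g)), signDot (A r) (fun i => (z i : ℝ)) ^ 2
        ≤ 3 / 10 * ((T ×ˢ (Finset.univ : Finset (Fin g))).card : ℝ) * ∑ i, (z i : ℝ) ^ 2
  let G' := G.filter fun z => z ≠ 0
  let 𝒯 : Finset (Finset U) := Finset.univ.filter fun T => Fintype.card U < 48 * T.card
  let bad := (Finset.univ.biUnion bad1) ∪ (G'.biUnion fun z => 𝒯.biUnion fun T => bad2 z T)
  set Ω : ℝ := (2 ^ n) ^ m with hΩ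
  have hΩpos : 0 < Ω := by positivity
  have hnm : n ≤ m := by
    rw [hm', mul_comm]
    refine le_trans ?_ hg
    exact Nat.le_mul_of_pos_left _ (by norm_num [spreadConst])
  have h1 : ((Finset.univ.biUnion bad1).card : ℝ) ≤ Ω * (1 / 3) := by
    calc ((Finset.univ.biUnion bad1).card : ℝ) ≤ ∑ v, ((bad1 v).card : ℝ) := by
          exact_mod_cast Finset.card_biUnion_le
      _ ≤ ∑ _v : Fin n → Bool, Ω * Real.exp (-(2 * m)) :=
          Finset.sum_le_sum fun v _ => card_large_image_le hn _ fun i => sgn_sq _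
      _ = Ω * (2 ^ n * Real.exp (-(2 * m))) := by simp; ring
      _ ≤ Ω * (1 / 3) := by
          gcongr
          have e6 : Real.exp (-2) ≤ 1 / 6 := by
            rw [Real.exp_neg, inv_le_comm₀ (Real.exp_pos _) (by norm_num)]
            have : Real.exp 2 = Real.exp 1 * Real.exp 1 := by rw [← Real.exp_add]; norm_num
            rw [this]
            nlinarith [Real.exp_one_gt_d9]
          have hnm' : (n : ℝ) ≤ m := by exact_mod_cast hnm
          calc 2 ^ n * Real.exp (-(2 * m)) ≤ 2 ^ n * Real.exp (-(2 * n)) := by gcongr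
            _ = (2 * Real.exp (-2)) ^ n := by
                rw [mul_pow, ← Real.exp_nat_mul]; ring_nf
            _ ≤ (1 / 3) ^ n := by gcongr; linarith
            _ ≤ (1 / 3) ^ 1 := pow_le_pow_of_le_one (by norm_num) (by norm_num) hn
            _ = 1 / 3 := by norm_num
  have h2 : ((G'.biUnion fun z => 𝒯.biUnion fun T => bad2 z T).card : ℝ) ≤ Ω * (1 / 2) := by
    -- Of the exponent `30004 n`, `30000 n` and `2 n` pay for the lattice points, `n` for the sets
    -- `T`, and the last `n` leaves the factor `1/2`. The factor `9` in `spreadConst` comes from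
    -- `(12/13)^9 ≤ 1/2`, and `48` from the size of `T`.
    have hb : ∀ z ∈ G', ∀ T ∈ 𝒯, ((bad2 z T).card : ℝ) ≤ Ω * (1 / 2) ^ (30004 * n) := by
      intro z hz T hT
      have hz0 : z ≠ 0 := (Finset.mem_filter.mp hz).2
      have hT0 : Fintype.card U < 48 * T.card := (Finset.mem_filter.mp hT).2
      have hpos : 0 < ∑ i, (z i : ℝ) ^ 2 := by
        obtain ⟨i, hi⟩ := Function.ne_iff.mp hz0
        refine Finset.sum_pos' (fun _ _ => by positivity) ⟨i, Finset.mem_univ _, ?_⟩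
        have : (z i : ℝ) ≠ 0 := by exact_mod_cast hi
        positivity
      refine (card_small_image_le (fun i => (z i : ℝ)) hpos
        (T ×ˢ (Finset.univ : Finset (Fin g)))).trans ?_
      have hc : 9 * (30004 * n) ≤ (T ×ˢ (Finset.univ : Finset (Fin g))).card := by
        rw [Finset.card_product, Finset.card_univ, Fintype.card_fin]
        have : g * Fintype.card U ≤ g * (48 * T.card) := Nat.mul_le_mul_left _ hT0.le
        have h3 := hg.trans this
        unfold spreadConst at h3
        nlinarith
      gcongr
      calc (12 / 13 : ℝ) ^ (T ×ˢ (Finset.univ : Finset (Fin g))).card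
          ≤ (12 / 13) ^ (9 * (30004 * n)) :=
            pow_le_pow_of_le_one (by norm_num) (by norm_num) hc
        _ = ((12 / 13) ^ 9) ^ (30004 * n) := pow_mul _ _ _
        _ ≤ _ := by gcongr; norm_num
    calc ((G'.biUnion fun z => 𝒯.biUnion fun T => bad2 z T).card : ℝ)
        ≤ ∑ z ∈ G', ∑ T ∈ 𝒯, ((bad2 z T).card : ℝ) := by
          have : (G'.biUnion fun z => 𝒯.biUnion fun T => bad2 z T).card
              ≤ ∑ z ∈ G', ∑ T ∈ 𝒯, (bad2 z T).card :=
            Finset.card_biUnion_le.trans (Finset.sum_le_sum fun z _ => Finset.card_biUnion_le)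
          exact_mod_cast this
      _ ≤ ∑ z ∈ G', ∑ T ∈ 𝒯, Ω * (1 / 2) ^ (30004 * n) :=
          Finset.sum_le_sum fun z hz => Finset.sum_le_sum fun T hT => hb z hz T hT
      _ = G'.card * (𝒯.card * (Ω * (1 / 2) ^ (30004 * n))) := by simp
      _ ≤ (2 ^ (30000 * n) * 3 ^ n) * (2 ^ n * (Ω * (1 / 2) ^ (30004 * n))) := by
          have c1 : (G'.card : ℝ) ≤ 2 ^ (30000 * n) * 3 ^ n :=
            (Nat.cast_le.mpr (Finset.card_filter_le _ _)).trans (card_intBall_le _ _)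
          have c2 : (𝒯.card : ℝ) ≤ 2 ^ n := by
            have : 𝒯.card ≤ 2 ^ n := by
              refine (Finset.card_le_univ _).trans ?_
              rw [Fintype.card_finset]
              exact Nat.pow_le_pow_right (by norm_num) hU
            exact_mod_cast this
          gcongr
      _ ≤ (2 ^ (30000 * n) * 4 ^ n) * (2 ^ n * (Ω * (1 / 2) ^ (30004 * n))) := by
          gcongr; norm_num
      _ = Ω * (1 / 2) ^ n := by
          have e4 : (4 : ℝ) ^ n = 2 ^ (2 * n) := by rw [pow_mul]; norm_num
          have e5 : (1 / 2 : ℝ) ^ (30004 * n)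
              = (1 / 2) ^ (30000 * n) * (1 / 2) ^ (2 * n) * (1 / 2) ^ n * (1 / 2) ^ n := by
            rw [← pow_add, ← pow_add, ← pow_add]; congr 1; ring
          have e6 : ∀ j : ℕ, (2 : ℝ) ^ j * (1 / 2) ^ j = 1 := fun j => by
            rw [← mul_pow]; norm_num
          rw [e4, e5]
          calc _ = Ω * (1 / 2) ^ n * ((2 : ℝ) ^ (30000 * n) * (1 / 2) ^ (30000 * n))
                * ((2 : ℝ) ^ (2 * n) * (1 / 2) ^ (2 * n)) * ((2 : ℝ) ^ n * (1 / 2) ^ n) := by ring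
            _ = _ := by rw [e6, e6, e6]; ring
      _ ≤ Ω * (1 / 2) ^ 1 := by
          gcongr Ω * ?_
          exact pow_le_pow_of_le_one (by norm_num) (by norm_num) hn
      _ = Ω * (1 / 2) := by norm_num
  have hcard : (bad.card : ℝ) < Fintype.card (U × Fin g → Fin n → Bool) := by
    have e : (Fintype.card (U × Fin g → Fin n → Bool) : ℝ) = Ω := by
      rw [hΩ, hm]
      simp only [Fintype.card_fun, Fintype.card_bool, Fintype.card_fin]
      push_cast
      rfl
    have : (bad.card : ℝ) ≤ (Finset.univ.biUnion bad1).card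
        + (G'.biUnion fun z => 𝒯.biUnion fun T => bad2 z T).card := by
      exact_mod_cast Finset.card_union_le _ _
    rw [e]
    linarith
  obtain ⟨A, -, hA⟩ := Finset.exists_mem_notMem_of_card_lt_card
    (s := bad) (t := Finset.univ) (by rw [Finset.card_univ]; exact_mod_cast hcard)
  simp only [bad, Finset.mem_union, not_or, Finset.mem_biUnion, not_exists, not_and] at hA
  refine ⟨A, fun v hv => ?_, fun z hz hz0 T hT => ?_⟩
  · have := hA.1 (fun i => decide (v i = 1)) (Finset.mem_univ _)
    simp only [bad1, Finset.mem_filter, Finset.mem_univ, true_and, not_le] at this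
    have e : (fun i => sgn (decide (v i = 1))) = v := by
      funext i
      rcases sq_eq_one_iff.mp (hv i) with h | h <;> norm_num [sgn, h]
    rw [e] at this
    exact this.le
  · have := hA.2 z (Finset.mem_filter.mpr ⟨hz, hz0⟩) T
      (Finset.mem_filter.mpr ⟨Finset.mem_univ _, hT⟩)
    simp only [bad2, Finset.mem_filter, Finset.mem_univ, true_and, not_le, Finset.card_product,
      Finset.card_univ, Fintype.card_fin, Nat.cast_mul] at this
    exact this

/-- There are few sign vectors, arranged in blocks, such that every real vector is seen with its
fair share of energy by all but a small fraction of the blocks. -/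
lemma exists_spread_signs (hn : 0 < n) (hU : Fintype.card U ≤ n)
    (hg : spreadConst * n ≤ g * Fintype.card U) :
    ∃ A : U → Fin g → Fin n → Bool, ∀ x : Fin n → ℝ,
      48 * (Finset.univ.filter fun u =>
        ∑ b, signDot (A u b) x ^ 2 < 1 / 50 * g * ∑ i, x i ^ 2).card ≤ Fintype.card U := by
  obtain ⟨A, hA1, hA2⟩ := exists_good_signs (U := U) hn hU hg
  have hn' : (0 : ℝ) < n := by exact_mod_cast hn
  have key : ∀ x : Fin n → ℝ, ∑ i, x i ^ 2 = n →
      48 * (Finset.univ.filter fun u =>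
        ∑ b, signDot (A (u, b)) x ^ 2 < 1 / 50 * g * ∑ i, x i ^ 2).card ≤ Fintype.card U := by
    intro x hx
    by_contra! hcon
    set T := Finset.univ.filter fun u =>
        ∑ b, signDot (A (u, b)) x ^ 2 < 1 / 50 * g * ∑ i, x i ^ 2 with hT
    -- The mesh `1/100` makes the error at most `1/200` per coordinate. The error is controlled in
    -- sup norm, so a bound on sign vectors suffices.
    let z : Fin n → ℤ := fun i => round (100 * x i)
    let x₀ : Fin n → ℝ := fun i => 1 / 100 * (z i : ℝ)
    let e : Fin n → ℝ := fun i => x₀ i - x i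
    have he : ∀ i, |e i| ≤ 1 / 200 := by
      intro i
      have := abs_sub_round (100 * x i)
      rw [abs_le] at this ⊢
      simp only [e, x₀, z]
      constructor <;> linarith [this.1, this.2]
    have he2 : ∑ i, e i ^ 2 ≤ n / 40000 := by
      calc ∑ i, e i ^ 2 ≤ ∑ _i : Fin n, (1 / 200 : ℝ) ^ 2 :=
            Finset.sum_le_sum fun i _ => sq_le_sq' (abs_le.mp (he i)).1 (abs_le.mp (he i)).2
        _ = _ := by simp; ring
    have hlow : (n : ℝ) / 4 ≤ ∑ i, x₀ i ^ 2 := by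
      have : ∑ i, x i ^ 2 ≤ 2 * ∑ i, x₀ i ^ 2 + 2 * ∑ i, e i ^ 2 := by
        rw [Finset.mul_sum, Finset.mul_sum, ← Finset.sum_add_distrib]
        refine Finset.sum_le_sum fun i _ => ?_
        simp only [e]
        nlinarith [sq_nonneg (x i - 2 * x₀ i)]
      linarith
    have hupp : ∑ i, x₀ i ^ 2 ≤ 3 * n := by
      have : ∑ i, x₀ i ^ 2 ≤ 2 * ∑ i, x i ^ 2 + 2 * ∑ i, e i ^ 2 := by
        rw [Finset.mul_sum, Finset.mul_sum, ← Finset.sum_add_distrib]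
        refine Finset.sum_le_sum fun i _ => ?_
        simp only [e]
        nlinarith [sq_nonneg (x₀ i - 2 * x i)]
      linarith
    have hz2 : ∑ i, x₀ i ^ 2 = 1 / 10000 * ∑ i, (z i : ℝ) ^ 2 := by
      rw [Finset.mul_sum]
      exact Finset.sum_congr rfl fun i _ => by simp only [x₀]; ring
    have hzmem : z ∈ intBall n (30000 * n) := by
      rw [mem_intBall]
      have h1 : ((∑ i, (z i).natAbs : ℕ) : ℝ) ≤ ∑ i, (z i : ℝ) ^ 2 := by
        push_cast
        refine Finset.sum_le_sum fun i _ => ?_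
        have : ((z i).natAbs : ℤ) ≤ z i ^ 2 := Int.natAbs_le_self_sq _
        calc ((z i).natAbs : ℝ) = (((z i).natAbs : ℤ) : ℝ) := (Int.cast_natCast _).symm
          _ ≤ ((z i ^ 2 : ℤ) : ℝ) := Int.cast_le.mpr this
          _ = (z i : ℝ) ^ 2 := by push_cast; rfl
      have h2 : ((∑ i, (z i).natAbs : ℕ) : ℝ) ≤ ((30000 * n : ℕ) : ℝ) := by
        push_cast at h1 ⊢
        linarith
      exact_mod_cast h2
    have hz0 : z ≠ 0 := by
      intro h
      rw [hz2, h] at hlow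
      simp at hlow
      linarith
    have hlarge := hA2 z hzmem hz0 T hcon
    have hop := sum_signDot_sq_le_of_abs_le A hA1 (by norm_num : (0 : ℝ) < 1 / 200) e he
    have hx0dot : ∀ r, signDot (A r) x₀ = 1 / 100 * signDot (A r) fun i => (z i : ℝ) :=
      fun r => signDot_smul _ _ _
    have hsplit : ∀ r, signDot (A r) x₀ ^ 2
        ≤ 2 * signDot (A r) x ^ 2 + 2 * signDot (A r) e ^ 2 := by
      intro r
      have : signDot (A r) x₀ = signDot (A r) x + signDot (A r) e := by
        rw [← signDot_add]
        congr 1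
        funext i
        simp only [e]
        ring
      rw [this]
      nlinarith [sq_nonneg (signDot (A r) x - signDot (A r) e)]
    have hs1 : ∑ r ∈ T ×ˢ (Finset.univ : Finset (Fin g)), signDot (A r) x ^ 2
        ≤ T.card * (1 / 50 * g * n) := by
      rw [Finset.sum_product, ← nsmul_eq_mul]
      refine Finset.sum_le_card_nsmul _ _ _ fun u hu => ?_
      rw [hT, Finset.mem_filter, hx] at hu
      exact hu.2.le
    have hs2 : ∑ r ∈ T ×ˢ (Finset.univ : Finset (Fin g)), signDot (A r) e ^ 2
        ≤ ∑ r, signDot (A r) e ^ 2 :=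
      Finset.sum_le_univ_sum_of_nonneg fun r => by positivity
    have hs3 : ∑ r ∈ T ×ˢ (Finset.univ : Finset (Fin g)), signDot (A r) x₀ ^ 2
        ≤ 2 * ∑ r ∈ T ×ˢ (Finset.univ : Finset (Fin g)), signDot (A r) x ^ 2
          + 2 * ∑ r ∈ T ×ˢ (Finset.univ : Finset (Fin g)), signDot (A r) e ^ 2 := by
      rw [Finset.mul_sum, Finset.mul_sum, ← Finset.sum_add_distrib]
      exact Finset.sum_le_sum fun r _ => hsplit r
    have hs4 : ∑ r ∈ T ×ˢ (Finset.univ : Finset (Fin g)), signDot (A r) x₀ ^ 2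
        = 1 / 10000 * ∑ r ∈ T ×ˢ (Finset.univ : Finset (Fin g)),
            signDot (A r) (fun i => (z i : ℝ)) ^ 2 := by
      rw [Finset.mul_sum]
      exact Finset.sum_congr rfl fun r _ => by rw [hx0dot]; ring
    have hcard : (Fintype.card (U × Fin g) : ℝ) ≤ 48 * (T.card * g) := by
      rw [Fintype.card_prod, Fintype.card_fin, Nat.cast_mul]
      have : (Fintype.card U : ℝ) ≤ 48 * T.card := by exact_mod_cast hcon.le
      calc (Fintype.card U : ℝ) * g ≤ (48 * T.card) * g := by gcongr
        _ = _ := by ring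
    have hX : (0 : ℝ) ≤ T.card * g * n := by positivity
    have hop2 : ∑ r, signDot (A r) e ^ 2 ≤ 480 / 40000 * (T.card * g * n) := by
      refine hop.trans ?_
      calc _ = 10 / 40000 * n * (Fintype.card (U × Fin g) : ℝ) := by ring
        _ ≤ 10 / 40000 * n * (48 * (T.card * g)) := by gcongr
        _ = _ := by ring
    have hlow2 : 3 / 10 * ((T.card : ℝ) * g) * (n / 4)
        ≤ 3 / 10 * ((T.card : ℝ) * g) * ∑ i, x₀ i ^ 2 := by gcongr
    have hlow3 : 3 / 10 * ((T.card : ℝ) * g) * ∑ i, x₀ i ^ 2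
        = 1 / 10000 * (3 / 10 * ((T.card : ℝ) * g) * ∑ i, (z i : ℝ) ^ 2) := by rw [hz2]; ring
    -- In units of `|T| g n`, the rounded vector has energy above `3/40 = 0.075` on `T`, while the
    -- splitting allows at most `2/50 + 2 · 480/40000 = 0.064`.
    linarith
  refine ⟨fun u b => A (u, b), fun x => ?_⟩
  have hq0 : 0 ≤ ∑ i, x i ^ 2 := Finset.sum_nonneg fun _ _ => sq_nonneg _
  rcases hq0.eq_or_lt with hq | hq
  · rw [← hq, Finset.filter_false_of_mem]
    · simp
    · intro u _
      rw [mul_zero, not_lt]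
      positivity
  · set q := ∑ i, x i ^ 2 with hqdef
    have hs : (√(n / q)) ^ 2 = n / q := Real.sq_sqrt (by positivity)
    have hpos : 0 < n / q := by positivity
    have hscale : ∑ i, (√(n / q) * x i) ^ 2 = n := by
      simp only [mul_pow, ← Finset.mul_sum, hs]
      rw [← hqdef]
      field_simp
    have h := key (fun i => √(n / q) * x i) hscale
    simp only [signDot_smul, mul_pow, ← Finset.mul_sum, hs] at h
    have e : ∀ u, (∑ b, signDot (A (u, b)) x ^ 2 < 1 / 50 * g * q) ↔
        (n / q * ∑ b, signDot (A (u, b)) x ^ 2 < 1 / 50 * g * (n / q * ∑ i, x i ^ 2)) := by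
      intro u
      rw [← hqdef, mul_left_comm (1 / 50 * (g : ℝ)), mul_lt_mul_iff_of_pos_left hpos]
    simp only [e]
    exact h

end Spread


/-! ### Expectations and variances under product weights. -/

/-- The expectation of `F` under the product of the finite weights `μ i`. -/
noncomputable def prodEx {ι β : Type*} [Fintype ι] [DecidableEq ι] [Fintype β] (μ : ι → β → ℝ)
    (F : (ι → β) → ℝ) : ℝ := ∑ y, (∏ i, μ i (y i)) * F y

section ProdEx

variable {ι β : Type*} [Fintype ι] [DecidableEq ι] [Fintype β] {μ : ι → β → ℝ}

lemma prodEx_add (F G : (ι → β) → ℝ) :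
    prodEx μ (fun y => F y + G y) = prodEx μ F + prodEx μ G := by
  simp [prodEx, mul_add, Finset.sum_add_distrib]

lemma prodEx_const_mul (c : ℝ) (F : (ι → β) → ℝ) :
    prodEx μ (fun y => c * F y) = c * prodEx μ F := by
  simp only [prodEx, Finset.mul_sum]
  exact Finset.sum_congr rfl fun y _ => by ring

lemma prodEx_sum {κ : Type*} (s : Finset κ) (F : κ → (ι → β) → ℝ) :
    prodEx μ (fun y => ∑ k ∈ s, F k y) = ∑ k ∈ s, prodEx μ (F k) := by
  simp only [prodEx, Finset.mul_sum]
  exact Finset.sum_comm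

lemma prodEx_prod (h : ι → β → ℝ) :
    prodEx μ (fun y => ∏ i, h i (y i)) = ∏ i, ∑ z, μ i z * h i z := by
  rw [Fintype.prod_sum]
  simp only [prodEx, Finset.prod_mul_distrib]

lemma prodEx_mono (hμ0 : ∀ i z, 0 ≤ μ i z) {F G : (ι → β) → ℝ} (h : ∀ y, F y ≤ G y) :
    prodEx μ F ≤ prodEx μ G :=
  Finset.sum_le_sum fun y _ =>
    mul_le_mul_of_nonneg_left (h y) (Finset.prod_nonneg fun i _ => hμ0 i _)

variable (hμ1 : ∀ i, ∑ z, μ i z = 1)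
include hμ1

lemma prodEx_const (c : ℝ) : prodEx μ (fun _ => c) = c := by
  have h := prodEx_prod (μ := μ) (fun _ _ => 1)
  simp only [mul_one, hμ1, Finset.prod_const_one] at h
  have h2 := prodEx_const_mul (μ := μ) c fun _ => 1
  rw [h] at h2
  simpa using h2

lemma prodEx_single (i : ι) (f : β → ℝ) : prodEx μ (fun y => f (y i)) = ∑ z, μ i z * f z := by
  have h := prodEx_prod (μ := μ) (fun l z => if l = i then f z else 1)
  have e : ∀ l, ∑ z, μ l z * (if l = i then f z else 1) = if l = i then ∑ z, μ l z * f z else 1 := by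
    intro l
    split_ifs
    · rfl
    · simpa using hμ1 l
  simp only [e, Finset.prod_ite_eq', Finset.mem_univ, if_true] at h
  exact h

omit hμ1 in
lemma prodEx_pair_eq_zero {i j : ι} (hij : i ≠ j) (f g : β → ℝ) (hf : ∑ z, μ i z * f z = 0) :
    prodEx μ (fun y => f (y i) * g (y j)) = 0 := by
  have h := prodEx_prod (μ := μ)
    (fun l z => (if l = i then f z else 1) * (if l = j then g z else 1))
  simp only [Finset.prod_mul_distrib, Finset.prod_ite_eq', Finset.mem_univ, if_true] at h
  rw [h]
  refine Finset.prod_eq_zero (Finset.mem_univ i) ?_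
  simpa [hij] using hf

omit [Fintype ι] [DecidableEq ι] in
lemma sum_mul_sub_sq_le (i : ι) (f : β → ℝ) (a : ℝ) :
    ∑ z, μ i z * (f z - ∑ w, μ i w * f w) ^ 2 ≤ ∑ z, μ i z * (f z - a) ^ 2 := by
  set m := ∑ w, μ i w * f w with hm
  have e : ∀ c : ℝ, ∑ z, μ i z * (f z - c) ^ 2 = ∑ z, μ i z * f z ^ 2 - 2 * c * m + c ^ 2 := by
    intro c
    have : ∀ z, μ i z * (f z - c) ^ 2
        = μ i z * f z ^ 2 - 2 * c * (μ i z * f z) + c ^ 2 * μ i z := fun z => by ring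
    simp only [this, Finset.sum_add_distrib, Finset.sum_sub_distrib, ← Finset.mul_sum, hμ1 i, ← hm]
    ring
  rw [e, e]
  nlinarith [sq_nonneg (a - m)]

/-- The second moment of a sum of independent terms; the variance of each is bounded by the second
moment about an arbitrary point. -/
lemma prodEx_sum_sub_sq_le (f : ι → β → ℝ) (c : ℝ) (a : ι → ℝ) :
    prodEx μ (fun y => (∑ i, f i (y i) - c) ^ 2)
      ≤ (∑ i, ∑ z, μ i z * f i z - c) ^ 2 + ∑ i, ∑ z, μ i z * (f i z - a i) ^ 2 := by
  set m : ι → ℝ := fun i => ∑ z, μ i z * f i z with hm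
  let k : ι → β → ℝ := fun i z => f i z - m i
  have hk : ∀ i, ∑ z, μ i z * k i z = 0 := by
    intro i
    simp only [k, mul_sub, Finset.sum_sub_distrib, ← Finset.sum_mul, hμ1 i, one_mul, hm, sub_self]
  have e : ∀ y : ι → β, (∑ i, f i (y i) - c) ^ 2
      = ∑ i, ∑ j, k i (y i) * k j (y j)
        + ((2 * (∑ i, m i - c)) * ∑ i, k i (y i) + (∑ i, m i - c) ^ 2) := by
    intro y
    rw [← Finset.sum_mul_sum]
    simp only [k, Finset.sum_sub_distrib]
    ring
  have hdiag : ∀ i, ∑ j, prodEx μ (fun y => k i (y i) * k j (y j)) = ∑ z, μ i z * k i z ^ 2 := by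
    intro i
    rw [Finset.sum_eq_single i]
    · rw [prodEx_single hμ1 i fun z => k i z * k i z]
      exact Finset.sum_congr rfl fun z _ => by ring
    · intro j _ hj
      exact prodEx_pair_eq_zero hj.symm _ _ (hk i)
    · simp
  simp only [e, prodEx_add, prodEx_const_mul, prodEx_sum, hdiag, prodEx_const hμ1]
  have hz : ∀ i, prodEx μ (fun y => k i (y i)) = 0 := fun i => by
    rw [prodEx_single hμ1 i (k i), hk]
  simp only [hz, Finset.sum_const_zero, mul_zero, zero_add]
  rw [add_comm]
  exact add_le_add le_rfl (Finset.sum_le_sum fun i _ => sum_mul_sub_sq_le hμ1 i (f i) (a i))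

end ProdEx

/-! ### The two-batch statistic: mean, variance and Chebyshev bounds. -/

section Statistic

variable {β : Type*} [Fintype β] [DecidableEq β] {g N : ℕ}

/-- The centred count of the symbol `z` in group `b`. -/
noncomputable def centredCount (ρ : Fin g → β → ℝ) (y : Fin g × Fin N → β) (b : Fin g) (z : β) :
    ℝ := ∑ i, ((if y (b, i) = z then 1 else 0) - ρ b z)

/-- The closeness statistic of two independent batches of messages. -/
noncomputable def crossStat (ρ : Fin g → β → ℝ) (y y' : Fin g × Fin N → β) : ℝ :=
  ∑ b, ∑ z, centredCount ρ y b z * centredCount ρ y' b z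

variable (π ρ : Fin g → β → ℝ)

lemma sum_centredCount_mul (y : Fin g × Fin N → β) (h : Fin g → β → ℝ) :
    ∑ b, ∑ z, centredCount ρ y b z * h b z
      = ∑ r : Fin g × Fin N, (h r.1 (y r) - ∑ z, ρ r.1 z * h r.1 z) := by
  rw [Fintype.sum_prod_type]
  refine Finset.sum_congr rfl fun b _ => ?_
  simp only [centredCount, Finset.sum_mul]
  rw [Finset.sum_comm]
  refine Finset.sum_congr rfl fun i _ => ?_
  simp [sub_mul, Finset.sum_sub_distrib]

variable {π} (hπ0 : ∀ b z, 0 ≤ π b z) (hπ1 : ∀ b, ∑ z, π b z = 1)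

include hπ1 in
/-- Second moment of a linear functional of the centred counts. -/
lemma prodEx_linear_sq_le (h : Fin g → β → ℝ) (c : ℝ) :
    prodEx (fun r : Fin g × Fin N => π r.1)
        (fun y => (∑ b, ∑ z, centredCount ρ y b z * h b z - c) ^ 2)
      ≤ (N * ∑ b, ∑ z, (π b z - ρ b z) * h b z - c) ^ 2 + N * ∑ b, ∑ z, π b z * h b z ^ 2 := by
  simp only [sum_centredCount_mul]
  -- Each term is `h` minus a constant; measuring its second moment about minus that constant leaves
  -- exactly `∑ π h²`.
  refine (prodEx_sum_sub_sq_le (μ := fun r : Fin g × Fin N => π r.1) (fun r => hπ1 r.1)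
    (fun r w => h r.1 w - ∑ z, ρ r.1 z * h r.1 z) c
    (fun r => -∑ z, ρ r.1 z * h r.1 z)).trans (le_of_eq ?_)
  have e1 : ∀ b : Fin g, ∑ z, π b z * (h b z - ∑ w, ρ b w * h b w)
      = ∑ z, (π b z - ρ b z) * h b z := by
    intro b
    simp only [mul_sub, sub_mul, Finset.sum_sub_distrib, ← Finset.sum_mul, hπ1 b, one_mul]
  simp only [Fintype.sum_prod_type, e1, sub_neg_eq_add, sub_add_cancel, Finset.sum_const,
    Finset.card_univ, Fintype.card_fin, nsmul_eq_mul, Finset.mul_sum]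

include hπ1 in
lemma prodEx_centredCount_sq_le (b : Fin g) (w : β) :
    prodEx (fun r : Fin g × Fin N => π r.1) (fun y => centredCount ρ y b w ^ 2)
      ≤ N ^ 2 * (π b w - ρ b w) ^ 2 + N * π b w := by
  have h := prodEx_linear_sq_le (N := N) ρ hπ1
    (fun b' z => if b' = b then if z = w then 1 else 0 else 0) 0
  have e1 : ∀ F : Fin g → β → ℝ,
      ∑ b', ∑ z, F b' z * (if b' = b then if z = w then (1 : ℝ) else 0 else 0) = F b w := by
    intro F
    rw [Finset.sum_eq_single b (by intro b' _ hb; simp [hb]) (by simp),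
      Finset.sum_eq_single w (by intro z _ hz; simp [hz]) (by simp)]
    simp
  have e2 : ∀ (b' : Fin g) (z : β), (if b' = b then if z = w then (1 : ℝ) else 0 else 0) ^ 2
      = if b' = b then if z = w then (1 : ℝ) else 0 else 0 := by
    intro b' z
    split_ifs <;> norm_num
  simp only [e2, e1, sub_zero] at h
  linarith [mul_pow (N : ℝ) (π b w - ρ b w) 2]

include hπ0 hπ1 in
/-- The variance of the closeness statistic. -/
lemma prodEx_crossStat_sq_le (D : ℝ) (hD : D = ∑ b, ∑ z, (π b z - ρ b z) ^ 2) :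
    prodEx (fun r : Fin g × Fin N => π r.1) (fun y' =>
      prodEx (fun r : Fin g × Fin N => π r.1) (fun y => (crossStat ρ y y' - N ^ 2 * D) ^ 2))
      ≤ 2 * N ^ 3 * (∑ b, ∑ z, π b z * (π b z - ρ b z) ^ 2) + N ^ 2 * ∑ b, ∑ z, π b z ^ 2 := by
  set V := ∑ b, ∑ z, π b z * (π b z - ρ b z) ^ 2 with hV
  have h1 : ∀ y' : Fin g × Fin N → β,
      prodEx (fun r : Fin g × Fin N => π r.1) (fun y => (crossStat ρ y y' - N ^ 2 * D) ^ 2)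
      ≤ (∑ b, ∑ z, centredCount ρ y' b z * (N * (π b z - ρ b z)) - N ^ 2 * D) ^ 2
        + N * ∑ b, ∑ z, π b z * centredCount ρ y' b z ^ 2 := by
    intro y'
    -- For fixed `y'` the statistic is linear in the counts of `y`. The resulting bound is then
    -- averaged over `y'`.
    refine (prodEx_linear_sq_le (N := N) ρ hπ1 (centredCount ρ y') (N ^ 2 * D)).trans (le_of_eq ?_)
    congr 3
    rw [Finset.mul_sum]
    refine Finset.sum_congr rfl fun b _ => ?_
    rw [Finset.mul_sum]
    exact Finset.sum_congr rfl fun z _ => by ring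
  refine (prodEx_mono (fun r z => hπ0 r.1 z) h1).trans ?_
  simp only [prodEx_add, prodEx_const_mul, prodEx_sum]
  have h2 := prodEx_linear_sq_le (N := N) ρ hπ1 (fun b z => N * (π b z - ρ b z)) (N ^ 2 * D)
  have e1 : (N : ℝ) * ∑ b, ∑ z, (π b z - ρ b z) * (N * (π b z - ρ b z)) = N ^ 2 * D := by
    rw [hD, Finset.mul_sum, Finset.mul_sum]
    refine Finset.sum_congr rfl fun b _ => ?_
    rw [Finset.mul_sum, Finset.mul_sum]
    exact Finset.sum_congr rfl fun z _ => by ring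
  have e2 : (N : ℝ) * ∑ b, ∑ z, π b z * (N * (π b z - ρ b z)) ^ 2 = N ^ 3 * V := by
    rw [hV, Finset.mul_sum, Finset.mul_sum]
    refine Finset.sum_congr rfl fun b _ => ?_
    rw [Finset.mul_sum, Finset.mul_sum]
    exact Finset.sum_congr rfl fun z _ => by ring
  rw [e1, e2, sub_self, zero_pow two_ne_zero, zero_add] at h2
  have h3 : (N : ℝ) * ∑ b, ∑ z, π b z *
      prodEx (fun r : Fin g × Fin N => π r.1) (fun y => centredCount ρ y b z ^ 2)
      ≤ N * ∑ b, ∑ z, π b z * (N ^ 2 * (π b z - ρ b z) ^ 2 + N * π b z) := by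
    exact mul_le_mul_of_nonneg_left (Finset.sum_le_sum fun b _ => Finset.sum_le_sum fun z _ =>
      mul_le_mul_of_nonneg_left (prodEx_centredCount_sq_le ρ hπ1 b z) (hπ0 b z))
      (Nat.cast_nonneg N)
  have e3 : (N : ℝ) * ∑ b, ∑ z, π b z * (N ^ 2 * (π b z - ρ b z) ^ 2 + N * π b z)
      = N ^ 3 * V + N ^ 2 * ∑ b, ∑ z, π b z ^ 2 := by
    rw [hV, Finset.mul_sum, Finset.mul_sum, Finset.mul_sum, ← Finset.sum_add_distrib]
    refine Finset.sum_congr rfl fun b _ => ?_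
    rw [Finset.mul_sum, Finset.mul_sum, Finset.mul_sum, ← Finset.sum_add_distrib]
    exact Finset.sum_congr rfl fun z _ => by ring
  linarith

omit [DecidableEq β] in
/-- Chebyshev's inequality for the closeness statistic. -/
lemma prodEx_prodEx_le_of_sq_le (hπ0 : ∀ b z, 0 ≤ π b z) {m V t : ℝ} (ht : 0 < t)
    (S : (Fin g × Fin N → β) → (Fin g × Fin N → β) → ℝ)
    (hV : prodEx (fun r : Fin g × Fin N => π r.1) (fun y' =>
      prodEx (fun r : Fin g × Fin N => π r.1) (fun y => (S y y' - m) ^ 2)) ≤ V)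
    (E : (Fin g × Fin N → β) → (Fin g × Fin N → β) → Prop) [∀ y y', Decidable (E y y')]
    (hE : ∀ y y', E y y' → t ≤ |S y y' - m|) :
    prodEx (fun r : Fin g × Fin N => π r.1) (fun y' =>
      prodEx (fun r : Fin g × Fin N => π r.1) (fun y => if E y y' then 1 else 0)) ≤ V / t ^ 2 := by
  rw [le_div_iff₀ (by positivity), mul_comm]
  refine le_trans ?_ hV
  calc t ^ 2 * prodEx (fun r : Fin g × Fin N => π r.1) (fun y' =>
        prodEx (fun r : Fin g × Fin N => π r.1) (fun y => if E y y' then 1 else 0))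
      = prodEx (fun r : Fin g × Fin N => π r.1) (fun y' =>
        prodEx (fun r : Fin g × Fin N => π r.1) (fun y => t ^ 2 * if E y y' then 1 else 0)) := by
        simp only [prodEx_const_mul]
    _ ≤ _ := by
        refine prodEx_mono (μ := fun r : Fin g × Fin N => π r.1) (fun r z => hπ0 r.1 z)
          fun y' => ?_
        refine prodEx_mono (μ := fun r : Fin g × Fin N => π r.1) (fun r z => hπ0 r.1 z)
          fun y => ?_
        split_ifs with h
        · rw [mul_one, ← sq_abs (S y y' - m)]
          exact pow_le_pow_left₀ ht.le (hE y y' h) 2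
        · rw [mul_zero]
          exact sq_nonneg _

variable {ρ} {r D₀ : ℝ}

/-- The mean vanishes and the variance is at most `N² g r`, so Chebyshev's inequality gives `4 g
r/(N D₀)²`. -/
lemma crossStat_null (hρ0 : ∀ b z, 0 ≤ ρ b z) (hρ1 : ∀ b, ∑ z, ρ b z = 1)
    (hρr : ∀ b z, ρ b z ≤ r) (hr : 0 < r) (hg : 0 < g) (hD₀ : 0 < D₀)
    (hN : 2000 * √(g * r) ≤ N * D₀) :
    prodEx (fun r : Fin g × Fin N => ρ r.1) (fun y' =>
      prodEx (fun r : Fin g × Fin N => ρ r.1)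
        (fun y => if N ^ 2 * D₀ / 2 < crossStat ρ y y' then 1 else 0)) ≤ 1 / 48 := by
  have hg' : (0 : ℝ) < g := by exact_mod_cast hg
  have hs : 0 < √(g * r) := Real.sqrt_pos.mpr (by positivity)
  have hs2 : √(g * r) ^ 2 = g * r := Real.sq_sqrt (by positivity)
  have hNpos : (0 : ℝ) < N := by
    by_contra! h
    nlinarith
  have hV := prodEx_crossStat_sq_le (N := N) ρ hρ0 hρ1 0 (by simp)
  simp only [sub_self, mul_zero, ne_eq, OfNat.ofNat_ne_zero, not_false_eq_true, zero_pow,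
    Finset.sum_const_zero, zero_add] at hV
  have h2 : ∑ b, ∑ z, ρ b z ^ 2 ≤ g * r := by
    calc ∑ b, ∑ z, ρ b z ^ 2 ≤ ∑ b, ∑ z, ρ b z * r :=
          Finset.sum_le_sum fun b _ => Finset.sum_le_sum fun z _ => by
            rw [sq]; exact mul_le_mul_of_nonneg_left (hρr b z) (hρ0 b z)
      _ = g * r := by simp [← Finset.sum_mul, hρ1]
  refine (prodEx_prodEx_le_of_sq_le hρ0 (t := N ^ 2 * D₀ / 2) (by positivity) _ hV _ ?_).trans ?_
  · intro y y' h
    rw [sub_zero]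
    exact h.le.trans (le_abs_self _)
  · rw [div_le_iff₀ (by positivity)]
    have : (2000 * √(g * r)) ^ 2 ≤ (N * D₀) ^ 2 := by gcongr
    rw [mul_pow, hs2] at this
    calc N ^ 2 * ∑ b, ∑ z, ρ b z ^ 2 ≤ (N : ℝ) ^ 2 * (g * r) := by gcongr
      _ ≤ (N : ℝ) ^ 2 * (1 / 192 * (N * D₀) ^ 2) := by
          have : 0 < (g : ℝ) * r := by positivity
          exact mul_le_mul_of_nonneg_left (by linarith) (by positivity)
      _ = _ := by ring

-- The deviation is measured against half the true mean `N² D`, so large `D` only helps. `π` has no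
-- a priori bound, but `π ≤ r + √D` pointwise, which controls the variance by `r` and `D`.
include hπ0 hπ1 in
lemma crossStat_alternative (hρ0 : ∀ b z, 0 ≤ ρ b z) (hρ1 : ∀ b, ∑ z, ρ b z = 1)
    (hρr : ∀ b z, ρ b z ≤ r) (hr : 0 < r) (hr2 : r ≤ 4) (hg : 0 < g) (hD₀ : 0 < D₀)
    (hD₀r : D₀ ≤ g * r) (hN : 2000 * √(g * r) ≤ N * D₀)
    (hD : D₀ ≤ ∑ b, ∑ z, (π b z - ρ b z) ^ 2) :
    prodEx (fun r : Fin g × Fin N => π r.1) (fun y' =>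
      prodEx (fun r : Fin g × Fin N => π r.1)
        (fun y => if crossStat ρ y y' ≤ N ^ 2 * D₀ / 2 then 1 else 0)) ≤ 1 / 48 := by
  have hg' : (1 : ℝ) ≤ g := by exact_mod_cast hg
  set s := √(g * r) with hs_def
  have hs : 0 < s := Real.sqrt_pos.mpr (by positivity)
  have hs2 : s ^ 2 = g * r := Real.sq_sqrt (by positivity)
  have hNpos : (0 : ℝ) < N := by
    by_contra! h
    nlinarith
  set D := ∑ b, ∑ z, (π b z - ρ b z) ^ 2 with hDdef
  have hDpos : 0 < D := hD₀.trans_le hD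
  have hrs : r ≤ 2 * s := by
    refine le_of_sq_le_sq ?_ (by positivity)
    rw [mul_pow, hs2]
    nlinarith
  have hX : 2000 * s ≤ N * D := hN.trans (by gcongr)
  -- This is where `D₀ ≤ g r` enters: one factor `D₀` of `(N D₀)²` is traded for `g r`.
  have hN2D : 2000 ^ 2 ≤ (N : ℝ) ^ 2 * D := by
    have h1 : (2000 * s) ^ 2 ≤ (N * D₀) ^ 2 := by gcongr
    rw [mul_pow, hs2] at h1
    have h2 : 2000 ^ 2 * (g * r) ≤ ((N : ℝ) ^ 2 * D₀) * (g * r) := by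
      calc _ ≤ (N * D₀) ^ 2 := h1
        _ = (N : ℝ) ^ 2 * D₀ * D₀ := by ring
        _ ≤ _ := by gcongr
    have h3 := le_of_mul_le_mul_right h2 (by positivity)
    exact h3.trans (by gcongr)
  have hd : ∀ b z, |π b z - ρ b z| ≤ √D := by
    intro b z
    refine Real.abs_le_sqrt ?_
    calc (π b z - ρ b z) ^ 2 ≤ ∑ z, (π b z - ρ b z) ^ 2 :=
          Finset.single_le_sum (f := fun z => (π b z - ρ b z) ^ 2) (fun _ _ => sq_nonneg _)
            (Finset.mem_univ z)
      _ ≤ D := Finset.single_le_sum (f := fun b => ∑ z, (π b z - ρ b z) ^ 2)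
            (fun _ _ => Finset.sum_nonneg fun _ _ => sq_nonneg _) (Finset.mem_univ b)
  have hV1 : ∑ b, ∑ z, π b z * (π b z - ρ b z) ^ 2 ≤ (r + √D) * D := by
    rw [hDdef, Finset.mul_sum]
    refine Finset.sum_le_sum fun b _ => ?_
    rw [Finset.mul_sum]
    refine Finset.sum_le_sum fun z _ => ?_
    gcongr
    linarith [(abs_le.mp (hd b z)).2, hρr b z]
  have hV2 : ∑ b, ∑ z, π b z ^ 2 ≤ 2 * (g * r) + 2 * D := by
    have h2 : ∑ b, ∑ z, ρ b z ^ 2 ≤ g * r := by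
      calc ∑ b, ∑ z, ρ b z ^ 2 ≤ ∑ b, ∑ z, ρ b z * r :=
            Finset.sum_le_sum fun b _ => Finset.sum_le_sum fun z _ => by
              rw [sq]; exact mul_le_mul_of_nonneg_left (hρr b z) (hρ0 b z)
        _ = g * r := by simp [← Finset.sum_mul, hρ1]
    calc ∑ b, ∑ z, π b z ^ 2 ≤ ∑ b, ∑ z, (2 * ρ b z ^ 2 + 2 * (π b z - ρ b z) ^ 2) :=
          Finset.sum_le_sum fun b _ => Finset.sum_le_sum fun z _ => by
            nlinarith [sq_nonneg (2 * ρ b z - π b z)]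
      _ = 2 * ∑ b, ∑ z, ρ b z ^ 2 + 2 * D := by
          simp only [Finset.sum_add_distrib, ← Finset.mul_sum, hDdef]
      _ ≤ _ := by linarith
  have hV := prodEx_crossStat_sq_le (N := N) ρ hπ0 hπ1 D hDdef
  refine (prodEx_prodEx_le_of_sq_le hπ0 (t := N ^ 2 * D / 2) (by positivity) _ hV _ ?_).trans ?_
  · intro y y' h
    rw [abs_sub_comm]
    refine le_trans ?_ (le_abs_self _)
    have : (N : ℝ) ^ 2 * D₀ ≤ N ^ 2 * D := by gcongr
    linarith
  · rw [div_le_iff₀ (by positivity)]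
    set q := √D with hq
    have hq2 : q ^ 2 = D := Real.sq_sqrt hDpos.le
    have hqpos : 0 < q := Real.sqrt_pos.mpr hDpos
    have hNq : 2000 ≤ N * q := by
      refine le_of_sq_le_sq ?_ (by positivity)
      rw [mul_pow, hq2]
      exact hN2D
    have hNN : (0 : ℝ) < N ^ 2 * (N * D) := by positivity
    have b1 : (N : ℝ) ^ 3 * (r * D) ≤ 1 / 1000 * (N ^ 2 * (N * D) ^ 2) := by
      have : r ≤ 1 / 1000 * (N * D) := by linarith
      calc (N : ℝ) ^ 3 * (r * D) = N ^ 2 * (N * D) * r := by ring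
        _ ≤ N ^ 2 * (N * D) * (1 / 1000 * (N * D)) := by gcongr
        _ = _ := by ring
    have b2 : (N : ℝ) ^ 3 * (q * D) ≤ 1 / 2000 * (N ^ 2 * (N * D) ^ 2) := by
      calc (N : ℝ) ^ 3 * (q * D) = N ^ 2 * (N * D) * q * (1 / 2000 * 2000) := by ring
        _ ≤ N ^ 2 * (N * D) * q * (1 / 2000 * (N * q)) := by gcongr
        _ = 1 / 2000 * (N ^ 2 * (N * D) * (N * q ^ 2)) := by ring
        _ = _ := by rw [hq2]; ring
    have b3 : (N : ℝ) ^ 2 * (g * r) ≤ 1 / 2000 ^ 2 * (N ^ 2 * (N * D) ^ 2) := by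
      have h1 : (2000 * s) ^ 2 ≤ (N * D) ^ 2 := by gcongr
      rw [mul_pow, hs2] at h1
      calc (N : ℝ) ^ 2 * (g * r) ≤ N ^ 2 * (1 / 2000 ^ 2 * (N * D) ^ 2) := by
            exact mul_le_mul_of_nonneg_left (by linarith) (by positivity)
        _ = _ := by ring
    have b4 : (N : ℝ) ^ 2 * D ≤ 1 / 2000 ^ 2 * (N ^ 2 * (N * D) ^ 2) := by
      calc (N : ℝ) ^ 2 * D = N ^ 2 * D * (1 / 2000 ^ 2 * 2000 ^ 2) := by ring
        _ ≤ N ^ 2 * D * (1 / 2000 ^ 2 * (N ^ 2 * D)) := by gcongr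
        _ = _ := by ring
    have hZ : 0 < (N : ℝ) ^ 2 * (N * D) ^ 2 := by positivity
    calc 2 * (N : ℝ) ^ 3 * (∑ b, ∑ z, π b z * (π b z - ρ b z) ^ 2) + N ^ 2 * ∑ b, ∑ z, π b z ^ 2
        ≤ 2 * (N : ℝ) ^ 3 * ((r + q) * D) + N ^ 2 * (2 * (g * r) + 2 * D) := by gcongr
      _ = 2 * ((N : ℝ) ^ 3 * (r * D)) + 2 * ((N : ℝ) ^ 3 * (q * D)) + 2 * ((N : ℝ) ^ 2 * (g * r))
          + 2 * ((N : ℝ) ^ 2 * D) := by ring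
      _ ≤ 1 / 192 * (N ^ 2 * (N * D) ^ 2) := by linarith
      _ = _ := by ring

end Statistic


/-! ### From one vector to all bins, and the geometry of the bin messages. -/

/-- The exceptional blocks vary with the bin, so a union bound over bins is unavailable. Instead, a
block that fails overall must fail on bins holding at least half the energy. On average over blocks
only `1/48` of the energy is lost, so Markov's inequality leaves at most `1/24` of the blocks. -/
lemma spread_direct_sum {U : Type} [Fintype U] [DecidableEq U] {n g M : ℕ}
    (A : U → Fin g → Fin n → Bool)
    (hA : ∀ x : Fin n → ℝ, 48 * (Finset.univ.filter fun u =>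
        ∑ b, signDot (A u b) x ^ 2 < 1 / 50 * g * ∑ i, x i ^ 2).card ≤ Fintype.card U)
    (X : Fin M → Fin n → ℝ) :
    24 * (Finset.univ.filter fun u =>
        ∑ b, ∑ a, signDot (A u b) (X a) ^ 2 < 1 / 100 * g * ∑ a, ∑ i, X a i ^ 2).card
      ≤ Fintype.card U := by
  classical
  set Q := ∑ a, ∑ i, X a i ^ 2 with hQ
  have hq : ∀ a, 0 ≤ ∑ i, X a i ^ 2 := fun a => Finset.sum_nonneg fun _ _ => sq_nonneg _
  have hQ0 : 0 ≤ Q := Finset.sum_nonneg fun a _ => hq a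
  set B := Finset.univ.filter fun u =>
        ∑ b, ∑ a, signDot (A u b) (X a) ^ 2 < 1 / 100 * g * Q with hB
  let bad (u : U) (a : Fin M) : Prop :=
    ∑ b, signDot (A u b) (X a) ^ 2 < 1 / 50 * g * ∑ i, X a i ^ 2
  rcases hQ0.eq_or_lt with h0 | hpos
  · rw [hB, ← h0, Finset.filter_false_of_mem]
    · simp
    · intro u _
      rw [mul_zero, not_lt]
      positivity
  have hbad : ∀ u ∈ B, Q / 2 ≤ ∑ a, if bad u a then ∑ i, X a i ^ 2 else 0 := by
    intro u hu
    have hu' : ∑ b, ∑ a, signDot (A u b) (X a) ^ 2 < 1 / 100 * g * Q := (Finset.mem_filter.mp hu).2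
    rw [Finset.sum_comm] at hu'
    have h1 : 1 / 50 * g * ∑ a, (if bad u a then 0 else ∑ i, X a i ^ 2)
        ≤ ∑ a, ∑ b, signDot (A u b) (X a) ^ 2 := by
      rw [Finset.mul_sum]
      refine Finset.sum_le_sum fun a _ => ?_
      split_ifs with h
      · rw [mul_zero]; positivity
      · exact not_lt.mp h
    have hg : (0 : ℝ) < g := by
      rcases Nat.eq_zero_or_pos g with h | h
      · subst h; simp at hu'
      · exact_mod_cast h
    have h2 : ∑ a, (if bad u a then 0 else ∑ i, X a i ^ 2) < Q / 2 := by
      by_contra! hcon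
      have : 1 / 50 * g * (Q / 2) ≤ 1 / 50 * g * ∑ a, (if bad u a then 0 else ∑ i, X a i ^ 2) := by
        gcongr
      linarith
    have h3 : Q = ∑ a, (if bad u a then ∑ i, X a i ^ 2 else 0)
        + ∑ a, (if bad u a then 0 else ∑ i, X a i ^ 2) := by
      rw [hQ, ← Finset.sum_add_distrib]
      refine Finset.sum_congr rfl fun a _ => ?_
      split_ifs <;> simp
    linarith
  have h1 : B.card * (Q / 2) ≤ ∑ u, ∑ a, if bad u a then ∑ i, X a i ^ 2 else 0 := by
    rw [← nsmul_eq_mul]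
    refine (Finset.card_nsmul_le_sum _ _ _ hbad).trans ?_
    refine Finset.sum_le_univ_sum_of_nonneg fun u => Finset.sum_nonneg fun a _ => ?_
    split_ifs
    · exact hq a
    · rfl
  have h2 : ∑ u, ∑ a, (if bad u a then ∑ i, X a i ^ 2 else 0) ≤ (Fintype.card U : ℝ) / 48 * Q := by
    rw [Finset.sum_comm, hQ, Finset.mul_sum]
    refine Finset.sum_le_sum fun a _ => ?_
    rw [← Finset.sum_filter, Finset.sum_const, nsmul_eq_mul]
    refine mul_le_mul_of_nonneg_right ?_ (hq a)
    rw [le_div_iff₀ (by norm_num), mul_comm]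
    exact_mod_cast hA (X a)
  have h3 : (B.card : ℝ) / 2 * Q ≤ (Fintype.card U : ℝ) / 48 * Q := by linarith
  have h4 := le_of_mul_le_mul_right h3 hpos
  have h5 : (24 : ℝ) * B.card ≤ Fintype.card U := by linarith
  exact_mod_cast h5

section Flattening

variable {k M n : ℕ} {m : Fin k → ℕ}

/-- The cell weights of a signed measure on copies placed injectively in a grid of cells. -/
noncomputable def cellWeight (φ : (Σ x, Fin (m x)) ↪ Fin M × Fin n) (w : (Σ x, Fin (m x)) → ℝ)
    (a : Fin M) (j : Fin n) : ℝ := ∑ c, if φ c = (a, j) then w c else 0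

lemma sum_cellWeight_mul (φ : (Σ x, Fin (m x)) ↪ Fin M × Fin n) (w : (Σ x, Fin (m x)) → ℝ)
    (h : Fin M → Fin n → ℝ) :
    ∑ a, ∑ j, cellWeight φ w a j * h a j = ∑ c, w c * h (φ c).1 (φ c).2 := by
  rw [← Fintype.sum_prod_type' (f := fun a j => cellWeight φ w a j * h a j)]
  simp only [cellWeight, Finset.sum_mul]
  rw [Finset.sum_comm]
  refine Finset.sum_congr rfl fun c _ => ?_
  rw [Finset.sum_eq_single (φ c)]
  · simp
  · intro z _ hz
    rw [if_neg (fun h => hz (by rw [h])), zero_mul]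
  · simp

lemma cellWeight_apply (φ : (Σ x, Fin (m x)) ↪ Fin M × Fin n) (w : (Σ x, Fin (m x)) → ℝ)
    (c : Σ x, Fin (m x)) : cellWeight φ w (φ c).1 (φ c).2 = w c := by
  simp [cellWeight]

lemma sum_cellWeight_sq (φ : (Σ x, Fin (m x)) ↪ Fin M × Fin n) (w : (Σ x, Fin (m x)) → ℝ) :
    ∑ a, ∑ j, cellWeight φ w a j ^ 2 = ∑ c, w c ^ 2 := by
  simp only [sq]
  rw [sum_cellWeight_mul]
  simp only [cellWeight_apply]

/-- The message announcing the bin of a copy and the sign of its position in the bin. -/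
def binMessage {β : Type*} (enc : Bool × Fin M ≃ β) (φ : (Σ x, Fin (m x)) ↪ Fin M × Fin n)
    (a : Fin n → Bool) (c : Σ x, Fin (m x)) : β := enc (a (φ c).2, (φ c).1)

/-- In each bin the signed sum is the difference of the masses of the two messages of that bin, and
`(s - s')² ≤ 2 (s² + s'²)`. -/
lemma sum_signDot_cellWeight_sq_le {β : Type*} [Fintype β] [DecidableEq β]
    (enc : Bool × Fin M ≃ β) (φ : (Σ x, Fin (m x)) ↪ Fin M × Fin n) (a : Fin n → Bool)
    (w : (Σ x, Fin (m x)) → ℝ) :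
    ∑ i, signDot a (cellWeight φ w i) ^ 2
      ≤ 2 * ∑ z, (∑ c, if binMessage enc φ a c = z then w c else 0) ^ 2 := by
  rw [← enc.sum_comp, Fintype.sum_prod_type, Fintype.sum_bool, ← Finset.sum_add_distrib,
    Finset.mul_sum]
  refine Finset.sum_le_sum fun i _ => ?_
  set s := fun b : Bool => ∑ c, if binMessage enc φ a c = enc (b, i) then w c else 0 with hs
  have e : signDot a (cellWeight φ w i) = s true - s false := by
    have h := sum_cellWeight_mul φ w fun i' j => if i' = i then sgn (a j) else 0
    rw [Finset.sum_eq_single i (fun i' _ hi' => by simp [hi']) (by simp)] at h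
    simp only [if_true] at h
    rw [hs, ← Finset.sum_sub_distrib, signDot]
    calc _ = ∑ j, cellWeight φ w i j * sgn (a j) := Finset.sum_congr rfl fun j _ => mul_comm _ _
      _ = _ := h
      _ = _ := by
        refine Finset.sum_congr rfl fun c _ => ?_
        simp only [binMessage, EmbeddingLike.apply_eq_iff_eq, Prod.mk.injEq]
        by_cases h1 : (φ c).1 = i <;> cases h2 : a (φ c).2 <;> simp [h1, sgn]
  rw [e]
  nlinarith [sq_nonneg (s true + s false)]

/-- A message determines the bin, so its copies occupy distinct positions among `n`. -/
lemma sum_binMessage_le {β : Type*} [DecidableEq β]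
    (enc : Bool × Fin M ≃ β) (φ : (Σ x, Fin (m x)) ↪ Fin M × Fin n) (a : Fin n → Bool)
    {w : (Σ x, Fin (m x)) → ℝ} {r : ℝ} (hr : 0 ≤ r) (hw : ∀ c, w c ≤ r) (z : β) :
    ∑ c, (if binMessage enc φ a c = z then w c else 0) ≤ n * r := by
  classical
  rw [← Finset.sum_filter]
  set S := Finset.univ.filter fun c => binMessage enc φ a c = z
  have hS : S.card ≤ n := by
    have : Set.InjOn (fun c => (φ c).2) S := by
      intro c hc c' hc' h
      have h1 : binMessage enc φ a c = z := (Finset.mem_filter.mp hc).2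
      have h2 : binMessage enc φ a c' = z := (Finset.mem_filter.mp hc').2
      have h3 := enc.injective (h1.trans h2.symm)
      exact φ.injective (Prod.ext (Prod.mk.inj h3).2 h)
    simpa using (Finset.card_image_of_injOn this).symm.trans_le (Finset.card_le_univ _)
  calc ∑ c ∈ S, w c ≤ S.card • r := Finset.sum_le_card_nsmul _ _ _ fun c _ => hw c
    _ = S.card * r := nsmul_eq_mul _ _
    _ ≤ n * r := by gcongr

end Flattening

/-! ### Flattening the reference distribution. -/

section Copies

variable {k : ℕ}

/-- The number of copies into which the element `x` is split. -/
noncomputable def copies (q : PMF (Fin k)) (x : Fin k) : ℕ := ⌊k * (q x).toReal⌋₊ + 1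

lemma sum_toReal {α : Type*} [Fintype α] (q : PMF α) : ∑ x, (q x).toReal = 1 := by
  rw [← ENNReal.toReal_sum fun x _ => q.apply_ne_top x, ← tsum_fintype (L := .unconditional _),
    q.tsum_coe, ENNReal.toReal_one]

/-- The floors sum to at most `k` by total mass one, and the added ones to `k`. The added one also
gives every element a copy, even where `q` vanishes. -/
lemma sum_copies_le (q : PMF (Fin k)) : ∑ x, copies q x ≤ 2 * k := by
  have h : ((∑ x, copies q x : ℕ) : ℝ) ≤ (2 * k : ℕ) := by
    push_cast
    calc ∑ x, (copies q x : ℝ) ≤ ∑ x, (k * (q x).toReal + 1) := by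
          refine Finset.sum_le_sum fun x _ => ?_
          simp only [copies]
          push_cast
          gcongr
          exact Nat.floor_le (by positivity)
      _ = 2 * k := by
          rw [Finset.sum_add_distrib, ← Finset.mul_sum, sum_toReal]
          simp
          ring
  exact_mod_cast h

lemma div_copies_le (hk : 0 < k) (q : PMF (Fin k)) (x : Fin k) :
    (q x).toReal / copies q x ≤ 1 / k := by
  have hk' : (0 : ℝ) < k := by exact_mod_cast hk
  have h := Nat.lt_floor_add_one (k * (q x).toReal)
  have hc : (0 : ℝ) < copies q x := by simp only [copies]; positivity
  rw [div_le_div_iff₀ hc hk']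
  simp only [copies]
  push_cast
  linarith

lemma lt_sum_abs_of_lt_tvDist (p q : PMF (Fin k)) {ε : ℝ} (h : ε < tvDist p q) :
    ε < ∑ x, |(p x).toReal - (q x).toReal| := by
  obtain ⟨S, hS⟩ := exists_lt_of_lt_ciSup h
  refine hS.trans_le ?_
  rw [← Finset.sum_sub_distrib]
  calc _ ≤ ∑ x ∈ S, |(p x).toReal - (q x).toReal| := Finset.sum_le_sum fun x _ => le_abs_self _
    _ ≤ _ := Finset.sum_le_univ_sum_of_nonneg fun x => abs_nonneg _

/-- The difference of two distributions, spread evenly over the copies. -/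
noncomputable def copyDiff (q p : PMF (Fin k)) (c : Σ x, Fin (copies q x)) : ℝ :=
  ((p c.1).toReal - (q c.1).toReal) / copies q c.1

/-- Cauchy–Schwarz with weights `copies q x`, whose sum is at most `2k`. -/
lemma le_sum_copyDiff_sq (hk : 0 < k) (q p : PMF (Fin k)) {ε : ℝ} (hε : 0 < ε)
    (h : ε < tvDist p q) : ε ^ 2 / (2 * k) ≤ ∑ c, copyDiff q p c ^ 2 := by
  have hk' : (0 : ℝ) < k := by exact_mod_cast hk
  have hc : ∀ x, (0 : ℝ) < copies q x := fun x => by simp only [copies]; positivity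
  have h1 := lt_sum_abs_of_lt_tvDist p q h
  have h2 : ∑ c, copyDiff q p c ^ 2
      = ∑ x, |(p x).toReal - (q x).toReal| ^ 2 / copies q x := by
    rw [Fintype.sum_sigma]
    refine Finset.sum_congr rfl fun x _ => ?_
    simp only [copyDiff, Finset.sum_const, Finset.card_univ, Fintype.card_fin, nsmul_eq_mul,
      sq_abs, div_pow]
    field_simp [(hc x).ne']
  rw [h2]
  refine le_trans ?_ (Finset.sq_sum_div_le_sum_sq_div _ _ fun x _ => hc x)
  have h3 : ∑ x, (copies q x : ℝ) ≤ 2 * k := by exact_mod_cast sum_copies_le q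
  have h4 : 0 < ∑ x, (copies q x : ℝ) :=
    Finset.sum_pos (fun x _ => hc x) ⟨⟨0, hk⟩, Finset.mem_univ _⟩
  gcongr

/-- The channel that picks a uniform copy of its input and applies `f` to it. -/
noncomputable def copyChannel {ℓ : ℕ} (q : PMF (Fin k)) (f : (Σ x, Fin (copies q x)) → Bits ℓ) :
    Channel k ℓ := fun x =>
  haveI : Nonempty (Fin (copies q x)) := ⟨⟨0, Nat.succ_pos _⟩⟩
  (PMF.uniformOfFintype (Fin (copies q x))).map fun c => f ⟨x, c⟩

lemma bind_copyChannel_toReal {ℓ : ℕ} (q p : PMF (Fin k)) (f : (Σ x, Fin (copies q x)) → Bits ℓ)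
    (z : Bits ℓ) :
    (p.bind (copyChannel q f) z).toReal
      = ∑ c, if f c = z then (p c.1).toReal / copies q c.1 else 0 := by
  rw [PMF.bind_apply, tsum_fintype, ENNReal.toReal_sum fun x _ =>
    ENNReal.mul_ne_top (p.apply_ne_top x) (PMF.apply_ne_top _ _), Fintype.sum_sigma]
  refine Finset.sum_congr rfl fun x _ => ?_
  rw [ENNReal.toReal_mul, copyChannel, PMF.map_apply, tsum_fintype, ENNReal.toReal_sum,
    Finset.mul_sum]
  · refine Finset.sum_congr rfl fun c _ => ?_
    by_cases h : f ⟨x, c⟩ = z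
    · simp [h, PMF.uniformOfFintype_apply, div_eq_mul_inv]
    · simp [h, Ne.symm h]
  · intro c _
    split_ifs
    · exact PMF.apply_ne_top _ _
    · exact ENNReal.zero_ne_top

lemma bind_copyChannel_sub {ℓ : ℕ} (q p : PMF (Fin k)) (f : (Σ x, Fin (copies q x)) → Bits ℓ)
    (z : Bits ℓ) :
    (p.bind (copyChannel q f) z).toReal - (q.bind (copyChannel q f) z).toReal
      = ∑ c, if f c = z then copyDiff q p c else 0 := by
  rw [bind_copyChannel_toReal, bind_copyChannel_toReal, ← Finset.sum_sub_distrib]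
  refine Finset.sum_congr rfl fun c _ => ?_
  split_ifs
  · rw [copyDiff, sub_div]
  · simp

end Copies

/-! ### The two-batch protocol and its verdict law. -/

section Protocol

variable {k ℓ s t n g N : ℕ}

/-- The first `t` bits of a string. -/
def firstBits (h : t ≤ s) (u : Bits s) : Bits t := fun j => u (Fin.castLE h j)

lemma sum_firstBits (h : t ≤ s) (F : Bits t → ℝ) :
    ∑ u : Bits s, F (firstBits h u) = 2 ^ (s - t) * ∑ v, F v := by
  obtain ⟨d, rfl⟩ := Nat.exists_eq_add_of_le h
  rw [← (Fin.appendEquiv t d).sum_comp, Fintype.sum_prod_type, Finset.mul_sum]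
  refine Finset.sum_congr rfl fun v _ => ?_
  have e : ∀ w : Fin d → Bool, firstBits h (Fin.appendEquiv t d (v, w)) = v := by
    intro w
    funext j
    exact Fin.append_left v w j
  simp [e]

/-- The index set of two batches of users, each consisting of `g` groups of size `N`. -/
abbrev Users (g N : ℕ) : Type := (Fin g × Fin N) ⊕ (Fin g × Fin N)

/-- The group of a user. -/
def Users.group : Users g N → Fin g := Sum.elim Prod.fst Prod.fst

/-- The protocol in which the channel of a user depends on its group and the first `t` public bits
and the server runs a deterministic test on the two batches of messages. -/
noncomputable def batchProtocol (h : t ≤ s) (e : Users g N ≃ Fin n)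
    (W : Bits t → Fin g → Channel k ℓ)
    (τ : Bits t → (Fin g × Fin N → Bits ℓ) → (Fin g × Fin N → Bits ℓ) → Fin 2) :
    SMPProtocol k ℓ s n where
  Seed _ := Unit
  seedLaw _ := PMF.pure ()
  select i u _ := W (firstBits h u) (e.symm i).group
  server u y := PMF.pure
    (τ (firstBits h u) (fun r => y (e (Sum.inl r))) (fun r => y (e (Sum.inr r))))

lemma batchProtocol_usesOnlyFirst (h : t ≤ s) (e : Users g N ≃ Fin n)
    (W : Bits t → Fin g → Channel k ℓ)
    (τ : Bits t → (Fin g × Fin N → Bits ℓ) → (Fin g × Fin N → Bits ℓ) → Fin 2) :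
    (batchProtocol h e W τ).UsesOnlyFirst t := by
  intro u v huv
  have : firstBits h u = firstBits h v := funext fun j => huv _ j.2
  constructor
  · intro i
    simp only [batchProtocol, this]
  · simp only [batchProtocol, this]

lemma sum_users {β : Type*} [Fintype β] (e : Users g N ≃ Fin n) (π : Fin g → β → ℝ)
    (F : (Fin g × Fin N → β) → (Fin g × Fin N → β) → ℝ) :
    ∑ y : Fin n → β, (∏ i, π (e.symm i).group (y i))
        * F (fun r => y (e (Sum.inl r))) (fun r => y (e (Sum.inr r)))
      = prodEx (fun r : Fin g × Fin N => π r.1) (fun y' =>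
          prodEx (fun r : Fin g × Fin N => π r.1) (fun y => F y y')) := by
  rw [← (((Equiv.sumArrowEquivProdArrow _ _ β).symm.trans
    (e.arrowCongr (Equiv.refl β)))).sum_comp, Fintype.sum_prod_type, Finset.sum_comm]
  simp only [prodEx]
  refine Finset.sum_congr rfl fun y' _ => ?_
  rw [Finset.mul_sum]
  refine Finset.sum_congr rfl fun y _ => ?_
  rw [← e.prod_comp, Fintype.prod_sum_type]
  simp [Users.group, Equiv.sumArrowEquivProdArrow, Equiv.arrowCongr]
  ring

lemma batchProtocol_verdict (h : t ≤ s) (e : Users g N ≃ Fin n)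
    (W : Bits t → Fin g → Channel k ℓ)
    (τ : Bits t → (Fin g × Fin N → Bits ℓ) → (Fin g × Fin N → Bits ℓ) → Fin 2)
    (p : PMF (Fin k)) (v : Fin 2) :
    ((batchProtocol h e W τ).verdictLaw p v).toReal
      = (2 ^ t)⁻¹ * ∑ w : Bits t,
        prodEx (fun (r : Fin g × Fin N) z => (p.bind (W w r.1) z).toReal) (fun y' =>
          prodEx (fun (r : Fin g × Fin N) z => (p.bind (W w r.1) z).toReal)
            (fun y => if τ w y y' = v then 1 else 0)) := by
  have key : ∀ u : Bits s,
      (((productLaw ((batchProtocol h e W τ).messageLaw p u)).bind fun y =>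
        (batchProtocol h e W τ).server u y) v).toReal
      = prodEx (fun (r : Fin g × Fin N) z => (p.bind (W (firstBits h u) r.1) z).toReal) (fun y' =>
          prodEx (fun (r : Fin g × Fin N) z => (p.bind (W (firstBits h u) r.1) z).toReal)
            (fun y => if τ (firstBits h u) y y' = v then 1 else 0)) := by
    intro u
    rw [← sum_users e (fun b z => (p.bind (W (firstBits h u) b) z).toReal)
      (fun y y' => if τ (firstBits h u) y y' = v then 1 else 0), PMF.bind_apply, tsum_fintype,
      ENNReal.toReal_sum fun y _ =>
        ENNReal.mul_ne_top (PMF.apply_ne_top _ _) (PMF.apply_ne_top _ _)]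
    refine Finset.sum_congr rfl fun y _ => ?_
    rw [ENNReal.toReal_mul]
    congr 1
    · rw [productLaw, PMF.ofFintype_apply, ENNReal.toReal_prod]
      refine Finset.prod_congr rfl fun i _ => ?_
      simp [SMPProtocol.messageLaw, batchProtocol]
    · simp only [batchProtocol, PMF.pure_apply]
      split_ifs with h1 h2 h2
      · simp
      · exact absurd h1.symm h2
      · exact absurd h2.symm h1
      · simp
  rw [SMPProtocol.verdictLaw, PMF.bind_apply, tsum_fintype, ENNReal.toReal_sum fun y _ =>
        ENNReal.mul_ne_top (PMF.apply_ne_top _ _) (PMF.apply_ne_top _ _)]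
  simp only [ENNReal.toReal_mul, key, PMF.uniformOfFintype_apply, ← Finset.mul_sum]
  rw [sum_firstBits h fun w =>
    prodEx (fun (r : Fin g × Fin N) z => (p.bind (W w r.1) z).toReal) (fun y' =>
          prodEx (fun (r : Fin g × Fin N) z => (p.bind (W w r.1) z).toReal)
            (fun y => if τ w y y' = v then 1 else 0)), ← mul_assoc]
  congr 1
  simp only [Fintype.card_fun, Fintype.card_bool, Fintype.card_fin, ENNReal.toReal_inv,
    Nat.cast_pow, Nat.cast_ofNat, ENNReal.toReal_pow, ENNReal.toReal_ofNat]
  rw [inv_mul_eq_div, div_eq_iff (by positivity), inv_mul_eq_div, eq_div_iff (by positivity),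
    ← pow_add, Nat.sub_add_cancel h]

end Protocol


/-! ### Assembling the identity test. -/

lemma prodEx_indicator_add_compl {κ β : Type*} [Fintype κ] [DecidableEq κ] [Fintype β]
    {μ : κ → β → ℝ} (hμ1 : ∀ i, ∑ z, μ i z = 1) (E : (κ → β) → (κ → β) → Prop)
    [∀ y y', Decidable (E y y')] :
    prodEx μ (fun y' => prodEx μ (fun y => if E y y' then 1 else 0))
      + prodEx μ (fun y' => prodEx μ (fun y => if ¬ E y y' then 1 else 0)) = 1 := by
  have e : ∀ y y' : κ → β, ((if E y y' then 1 else 0) + (if ¬ E y y' then 1 else 0) : ℝ) = 1 := by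
    intro y y'
    by_cases h : E y y' <;> simp [h]
  simp only [← prodEx_add, e, prodEx_const hμ1]

lemma prodEx_indicator_nonneg {κ β : Type*} [Fintype κ] [DecidableEq κ] [Fintype β]
    {μ : κ → β → ℝ} (hμ0 : ∀ i z, 0 ≤ μ i z) (E : (κ → β) → (κ → β) → Prop)
    [∀ y y', Decidable (E y y')] :
    0 ≤ prodEx μ (fun y' => prodEx μ (fun y => if E y y' then 1 else 0)) := by
  refine Finset.sum_nonneg fun y' _ => mul_nonneg (Finset.prod_nonneg fun i _ => hμ0 i _) ?_
  refine Finset.sum_nonneg fun y _ => mul_nonneg (Finset.prod_nonneg fun i _ => hμ0 i _) ?_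
  beta_reduce
  split_ifs <;> norm_num

/-- The error budget over public strings: `(23/24) · (47/48) > 11/12`. -/
lemma lt_sum_of_few_exceptions {U : Type*} [Fintype U] [DecidableEq U] [Nonempty U] {F : U → ℝ}
    (hF : ∀ w, 0 ≤ F w) (B : Finset U) (hB : 24 * B.card ≤ Fintype.card U)
    (hw : ∀ w ∈ Bᶜ, 47 / 48 ≤ F w) : (1 - 1 / 12) * (Fintype.card U : ℝ) < ∑ w, F w := by
  have h3 : ((Bᶜ).card : ℝ) * (47 / 48) ≤ ∑ w, F w := by
    rw [← nsmul_eq_mul]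
    exact (Finset.card_nsmul_le_sum (Bᶜ) _ _ hw).trans (Finset.sum_le_univ_sum_of_nonneg hF)
  have h4 : ((Bᶜ).card : ℝ) = Fintype.card U - B.card := by
    rw [Finset.card_compl, Nat.cast_sub (Finset.card_le_univ _)]
  have h5 : 24 * (B.card : ℝ) ≤ Fintype.card U := by exact_mod_cast hB
  have h6 : (0 : ℝ) < Fintype.card U := by exact_mod_cast Fintype.card_pos
  rw [h4] at h3
  linarith

/-- Identity testing by flattening, spread sign functionals within bins, and the closeness
statistic, with `m` cells per bin and two batches of `g` groups of `N` users. -/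
lemma exists_identityTest {k ℓ s t m g N : ℕ} {ε : ℝ} (hk : 0 < k) (hℓ : 1 ≤ ℓ) (h : t ≤ s)
    (hε : 0 < ε) (hε1 : ε < 1) (hm : 2 * k ≤ 2 ^ (ℓ - 1) * m) (hm4 : m ≤ 4 * k) (htm : 2 ^ t ≤ m)
    (hg : spreadConst * m ≤ g * 2 ^ t)
    (hN : 2000 * √(g * (m / k)) ≤ N * (g * ε ^ 2 / (400 * k))) (q : PMF (Fin k)) :
    ∃ P : SMPProtocol k ℓ s (2 * (g * N)), P.UsesOnlyFirst t ∧ P.IsIdentityTest q ε (1 / 12) := by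
  classical
  have hk' : (0 : ℝ) < k := by exact_mod_cast hk
  have hmpos : 0 < m := lt_of_lt_of_le (by positivity) htm
  have hm' : (1 : ℝ) ≤ m := by exact_mod_cast hmpos
  have hcardU : Fintype.card (Bits t) = 2 ^ t := by simp
  obtain ⟨A, hA⟩ := exists_spread_signs (U := Bits t) (g := g) hmpos (by rw [hcardU]; exact htm)
    (by rw [hcardU]; exact hg)
  have hgpos : 0 < g := by
    rcases Nat.eq_zero_or_pos g with h0 | h0
    · rw [h0, zero_mul, Nat.le_zero, Nat.mul_eq_zero] at hg
      rcases hg with h1 | h1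
      · norm_num [spreadConst] at h1
      · omega
    · exact h0
  have hg' : (0 : ℝ) < g := by exact_mod_cast hgpos
  obtain ⟨φ⟩ : Nonempty ((Σ x, Fin (copies q x)) ↪ Fin (2 ^ (ℓ - 1)) × Fin m) := by
    refine Function.Embedding.nonempty_of_card_le ?_
    rw [Fintype.card_sigma, Fintype.card_prod]
    simp only [Fintype.card_fin]
    exact (sum_copies_le q).trans hm
  let enc : Bool × Fin (2 ^ (ℓ - 1)) ≃ Bits ℓ := Fintype.equivOfCardEq (by
    simp only [Fintype.card_prod, Fintype.card_bool, Fintype.card_fin, Fintype.card_fun]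
    rw [← pow_succ', Nat.sub_add_cancel hℓ])
  let e : Users g N ≃ Fin (2 * (g * N)) := Fintype.equivFinOfCardEq (by simp; ring)
  let W : Bits t → Fin g → Channel k ℓ := fun w b => copyChannel q (binMessage enc φ (A w b))
  let law : PMF (Fin k) → Bits t → Fin g → Bits ℓ → ℝ := fun p w b z => (p.bind (W w b) z).toReal
  have hlaw0 : ∀ p w b z, 0 ≤ law p w b z := fun p w b z => ENNReal.toReal_nonneg
  have hlaw1 : ∀ p w b, ∑ z, law p w b z = 1 := fun p w b => sum_toReal _
  have hlawr : ∀ w b z, law q w b z ≤ m / k := by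
    intro w b z
    simp only [law, W]
    rw [bind_copyChannel_toReal, div_eq_mul_one_div]
    exact sum_binMessage_le enc φ (A w b) (by positivity) (fun c => div_copies_le hk q c.1) z
  -- The factor `400` collects `2k` from flattening, `100` from spreading, and `2` from passing from
  -- signed sums to message laws.
  set D₀ : ℝ := g * ε ^ 2 / (400 * k) with hD₀
  have hD₀pos : 0 < D₀ := by positivity
  let τ : Bits t → (Fin g × Fin N → Bits ℓ) → (Fin g × Fin N → Bits ℓ) → Fin 2 := fun w y y' =>
    if crossStat (law q w) y y' ≤ N ^ 2 * D₀ / 2 then 0 else 1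
  have hτ0 : ∀ w y y', τ w y y' = 0 ↔ crossStat (law q w) y y' ≤ N ^ 2 * D₀ / 2 := by
    intro w y y'
    simp only [τ]
    split_ifs with h1 <;> simp [h1]
  have hτ1 : ∀ w y y', τ w y y' = 1 ↔ ¬ crossStat (law q w) y y' ≤ N ^ 2 * D₀ / 2 := by
    intro w y y'
    simp only [τ]
    split_ifs with h1 <;> simp [h1]
  refine ⟨batchProtocol h e W τ, batchProtocol_usesOnlyFirst h e W τ, fun p => ⟨?_, ?_⟩⟩
  · rintro rfl
    rw [batchProtocol_verdict]
    simp only [hτ0]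
    have hw : ∀ w : Bits t, 47 / 48 ≤
        prodEx (fun (r : Fin g × Fin N) z => law p w r.1 z) (fun y' =>
          prodEx (fun (r : Fin g × Fin N) z => law p w r.1 z)
            (fun y => if crossStat (law p w) y y' ≤ N ^ 2 * D₀ / 2 then 1 else 0)) := by
      intro w
      have h1 := crossStat_null (N := N) (hlaw0 p w) (hlaw1 p w) (hlawr w)
        (by positivity : (0 : ℝ) < m / k) hgpos hD₀pos hN
      have h2 := prodEx_indicator_add_compl (μ := fun (r : Fin g × Fin N) z => law p w r.1 z)
        (fun r => hlaw1 p w r.1) (fun y y' => crossStat (law p w) y y' ≤ N ^ 2 * D₀ / 2)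
      simp only [not_le] at h2
      linarith
    have h3 := lt_sum_of_few_exceptions
      (fun w => le_trans (by norm_num) (hw w)) ∅ (by simp) fun w _ => hw w
    rw [hcardU] at h3
    push_cast at h3
    rw [inv_mul_eq_div, lt_div_iff₀ (by positivity)]
    exact h3
  · intro hp
    rw [batchProtocol_verdict]
    simp only [hτ1]
    set B := Finset.univ.filter fun w : Bits t =>
      ∑ b, ∑ a, signDot (A w b) (cellWeight φ (copyDiff q p) a) ^ 2
        < 1 / 100 * g * ∑ a, ∑ i, cellWeight φ (copyDiff q p) a i ^ 2 with hB
    have hBcard : 24 * B.card ≤ 2 ^ t := by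
      rw [← hcardU]
      exact spread_direct_sum A hA (cellWeight φ (copyDiff q p))
    have hw : ∀ w ∈ Bᶜ, 47 / 48 ≤
        prodEx (fun (r : Fin g × Fin N) z => law p w r.1 z) (fun y' =>
          prodEx (fun (r : Fin g × Fin N) z => law p w r.1 z)
            (fun y => if ¬ crossStat (law q w) y y' ≤ N ^ 2 * D₀ / 2 then 1 else 0)) := by
      intro w hw
      rw [Finset.mem_compl, hB, Finset.mem_filter, not_and, not_lt, sum_cellWeight_sq] at hw
      have hw1 := hw (Finset.mem_univ _)
      have hw2 : ∑ b, ∑ a, signDot (A w b) (cellWeight φ (copyDiff q p) a) ^ 2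
          ≤ 2 * ∑ b, ∑ z, (law p w b z - law q w b z) ^ 2 := by
        rw [Finset.mul_sum]
        refine Finset.sum_le_sum fun b _ => ?_
        refine (sum_signDot_cellWeight_sq_le enc φ (A w b) (copyDiff q p)).trans (le_of_eq ?_)
        simp only [law, W, bind_copyChannel_sub]
      have hw3 := le_sum_copyDiff_sq hk q p hε hp
      have hD : D₀ ≤ ∑ b, ∑ z, (law p w b z - law q w b z) ^ 2 := by
        have : 1 / 100 * (g : ℝ) * (ε ^ 2 / (2 * k)) ≤ 1 / 100 * g * ∑ c, copyDiff q p c ^ 2 := by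
          gcongr
        have e : D₀ = 1 / 2 * (1 / 100 * (g : ℝ) * (ε ^ 2 / (2 * k))) := by
          rw [hD₀]; field_simp; norm_num
        linarith
      have hr4 : (m : ℝ) / k ≤ 4 := by
        rw [div_le_iff₀ hk']
        exact_mod_cast hm4
      have hDr : D₀ ≤ g * (m / k) := by
        rw [hD₀, mul_div_assoc]
        gcongr g * ?_
        rw [div_le_div_iff₀ (by positivity) hk']
        have : ε ^ 2 ≤ 1 := by nlinarith
        nlinarith
      have h1 := crossStat_alternative (N := N) (hlaw0 p w) (hlaw1 p w) (hlaw0 q w) (hlaw1 q w)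
        (hlawr w) (by positivity : (0 : ℝ) < m / k) hr4 hgpos hD₀pos hDr hN hD
      have h2 := prodEx_indicator_add_compl (μ := fun (r : Fin g × Fin N) z => law p w r.1 z)
        (fun r => hlaw1 p w r.1) (fun y y' => crossStat (law q w) y y' ≤ N ^ 2 * D₀ / 2)
      linarith
    have hnonneg : ∀ w, 0 ≤
        prodEx (fun (r : Fin g × Fin N) z => law p w r.1 z) (fun y' =>
          prodEx (fun (r : Fin g × Fin N) z => law p w r.1 z)
            (fun y => if ¬ crossStat (law q w) y y' ≤ N ^ 2 * D₀ / 2 then 1 else 0)) := fun w =>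
      prodEx_indicator_nonneg (μ := fun (r : Fin g × Fin N) z => law p w r.1 z)
        (fun r => hlaw0 p w r.1) fun y y' => ¬ crossStat (law q w) y y' ≤ N ^ 2 * D₀ / 2
    have h3 := lt_sum_of_few_exceptions hnonneg B (by rw [hcardU]; exact hBcard) hw
    rw [hcardU] at h3
    push_cast at h3
    rw [inv_mul_eq_div, lt_div_iff₀ (by positivity)]
    exact h3

/-! ### Sample-size arithmetic and the main theorem. -/

/-- The number of public bits used by the protocol fits into the domain size. -/
lemma two_pow_min_bounds {k ℓ s : ℕ} (hk : 1 ≤ k) (hℓ : 1 ≤ ℓ) :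
    2 ^ min (Nat.log 2 k - ℓ) s ≤ 2 * k / 2 ^ (ℓ - 1) + 1 ∧
    max ((k : ℝ) / 2 ^ ℓ) 1 / 2 ^ min (Nat.log 2 k - ℓ) s
      ≤ 2 * max ((k : ℝ) / 2 ^ (s + ℓ)) 1 := by
  set t := min (Nat.log 2 k - ℓ) s with ht
  have hlog : 2 ^ Nat.log 2 k ≤ k := Nat.pow_log_le_self 2 (by omega)
  have hlog2 : k < 2 ^ (Nat.log 2 k + 1) := Nat.lt_pow_succ_log_self (by norm_num) k
  constructor
  · rcases le_total (Nat.log 2 k) ℓ with h | h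
    -- Truncated subtraction makes the protocol ignore the public string here, and the added one in
    -- `m` is enough.
    · have : t = 0 := by omega
      rw [this]
      simp
    · refine le_trans ?_ (Nat.le_succ _)
      rw [Nat.le_div_iff_mul_le (by positivity), ← pow_add]
      calc 2 ^ (t + (ℓ - 1)) ≤ 2 ^ Nat.log 2 k := Nat.pow_le_pow_right (by norm_num) (by omega)
        _ ≤ 2 * k := by omega
  · rw [div_le_iff₀ (by positivity)]
    have hone : (1 : ℝ) ≤ 2 ^ t := one_le_pow₀ (by norm_num)
    have hmx : (1 : ℝ) ≤ max ((k : ℝ) / 2 ^ (s + ℓ)) 1 := le_max_right _ _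
    refine max_le ?_ (by nlinarith)
    rcases le_total s (Nat.log 2 k - ℓ) with h | h
    · have e : t = s := by omega
      rw [e] at hone ⊢
      have h1 : (k : ℝ) / 2 ^ (s + ℓ) ≤ max ((k : ℝ) / 2 ^ (s + ℓ)) 1 := le_max_left _ _
      have h2 : (k : ℝ) / 2 ^ ℓ = k / 2 ^ (s + ℓ) * 2 ^ s := by
        rw [pow_add]; field_simp
      have h3 : (0 : ℝ) ≤ k / 2 ^ (s + ℓ) := by positivity
      rw [h2]
      gcongr
      linarith
    · have hk2 : (k : ℝ) ≤ 2 * 2 ^ t * 2 ^ ℓ := by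
        have : k ≤ 2 * 2 ^ t * 2 ^ ℓ := by
          rw [← pow_succ', ← pow_add]
          exact hlog2.le.trans (Nat.pow_le_pow_right (by norm_num) (by omega))
        exact_mod_cast this
      calc (k : ℝ) / 2 ^ ℓ ≤ 2 * 2 ^ t := by rwa [div_le_iff₀ (by positivity)]
        _ = 2 * 1 * 2 ^ t := by ring
        _ ≤ _ := by gcongr

/-- The sample size of the protocol in terms of its parameters. -/
lemma sampleSize_le {k m S g N : ℕ} {ε : ℝ} (hk : 0 < k) (hS : 0 < S) (hSm : S ≤ m) (hε : 0 < ε)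
    (hε1 : ε < 1) (hg : g = spreadConst * (m / S + 1))
    (hN : N = ⌈2000 * √(g * ((m : ℝ) / k)) / (g * ε ^ 2 / (400 * k))⌉₊) :
    ((2 * (g * N) : ℕ) : ℝ) ≤ 3200004 * spreadConst * (m * √(k / S)) / ε ^ 2 := by
  have hk' : (1 : ℝ) ≤ k := by exact_mod_cast hk
  have hS' : (1 : ℝ) ≤ S := by exact_mod_cast hS
  have hSm' : (S : ℝ) ≤ m := by exact_mod_cast hSm
  have hC : (1 : ℝ) ≤ spreadConst := by norm_num [spreadConst]
  have hgpos : (0 : ℝ) < g := by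
    rw [hg]; push_cast; positivity
  have hgle : (g : ℝ) ≤ 2 * spreadConst * (m / S) := by
    rw [hg]
    push_cast
    have h1 : ((m / S : ℕ) : ℝ) ≤ m / S := Nat.cast_div_le
    have h2 : (1 : ℝ) ≤ m / S := by rwa [le_div_iff₀ (by linarith), one_mul]
    nlinarith
  set R := √((k : ℝ) / S) with hR
  have hR2 : R ^ 2 = k / S := Real.sq_sqrt (by positivity)
  have hR0 : 0 ≤ R := Real.sqrt_nonneg _
  have hsq : k * √(g * ((m : ℝ) / k)) ≤ 2 * spreadConst * (m * R) := by
    have h1 : (0 : ℝ) ≤ 2 * spreadConst * (m * R) := by positivity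
    refine le_of_sq_le_sq ?_ h1
    rw [mul_pow, Real.sq_sqrt (by positivity), mul_pow, mul_pow, mul_pow, hR2]
    calc (k : ℝ) ^ 2 * (g * (m / k)) = k * m * g := by field_simp
      _ ≤ k * m * (2 * spreadConst * (m / S)) := by gcongr
      _ = (2 * spreadConst) * (m ^ 2 * (k / S)) := by ring
      _ ≤ (2 ^ 2 * (spreadConst : ℝ) ^ 2) * (m ^ 2 * (k / S)) := by
          refine mul_le_mul_of_nonneg_right ?_ (by positivity)
          nlinarith
  -- Needed to absorb the extra user per group created by the ceiling in `N`.
  have hRS : 1 / (S : ℝ) ≤ R := by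
    refine le_of_sq_le_sq ?_ hR0
    rw [hR2, div_pow, one_pow, div_le_div_iff₀ (by positivity) (by positivity)]
    nlinarith [mul_le_mul hk' hS' zero_le_one (by linarith)]
  have hε2 : 0 < ε ^ 2 := by positivity
  have hε3 : ε ^ 2 ≤ 1 := by nlinarith
  have hNle : (N : ℝ) ≤ 2000 * √(g * ((m : ℝ) / k)) / (g * ε ^ 2 / (400 * k)) + 1 := by
    rw [hN]
    exact (Nat.ceil_lt_add_one (by positivity)).le
  push_cast
  calc (2 : ℝ) * (g * N)
      ≤ 2 * (g * (2000 * √(g * ((m : ℝ) / k)) / (g * ε ^ 2 / (400 * k)) + 1)) := by gcongr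
    _ = 1600000 * (k * √(g * ((m : ℝ) / k))) / ε ^ 2 + 2 * g := by field_simp; ring
    _ ≤ 1600000 * (2 * spreadConst * (m * R)) / ε ^ 2 + 4 * spreadConst * (m * R) / ε ^ 2 := by
        refine add_le_add (by gcongr) ?_
        calc (2 : ℝ) * g ≤ 2 * (2 * spreadConst * (m / S)) := by gcongr
          _ = 4 * spreadConst * (m * (1 / S)) := by ring
          _ ≤ 4 * spreadConst * (m * R) := by gcongr
          _ ≤ 4 * spreadConst * (m * R) / ε ^ 2 := by
              rw [le_div_iff₀ hε2]
              exact mul_le_of_le_one_right (by positivity) hε3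
    _ = _ := by ring

lemma cells_mul_sqrt_le {k m S : ℕ} {a b : ℝ} (hS : 0 < S) (ha : 0 ≤ a)
    (hb : 0 ≤ b) (hm : (m : ℝ) ≤ 5 * a) (hab : a / S ≤ 2 * b) :
    m * √((k : ℝ) / S) ≤ 10 * (√k * √a * √b) := by
  have hS' : (0 : ℝ) < S := by exact_mod_cast hS
  refine le_of_sq_le_sq ?_ (by positivity)
  rw [mul_pow, Real.sq_sqrt (by positivity), mul_pow, mul_pow, mul_pow, Real.sq_sqrt (by positivity),
    Real.sq_sqrt ha, Real.sq_sqrt hb]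
  calc (m : ℝ) ^ 2 * (k / S) ≤ (5 * a) ^ 2 * (k / S) := by gcongr
    _ = 25 * k * a * (a / S) := by ring
    _ ≤ 25 * k * a * (2 * b) := by gcongr
    _ ≤ 10 ^ 2 * (k * a * b) := by
        have : 0 ≤ k * a * b := by positivity
        linarith

end DistTesting

theorem mainTheorem2 :
    ∃ C : ℝ, 0 < C ∧ ∀ (k ℓ s : ℕ) (ε : ℝ), 1 ≤ k → 1 ≤ ℓ → 0 < ε → ε < 1 →
      ∃ n : ℕ,
        (n : ℝ) ≤ C * (√(k : ℝ) / ε ^ 2 * √(max ((k : ℝ) / 2 ^ ℓ) 1)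
          * √(max ((k : ℝ) / 2 ^ (s + ℓ)) 1)) ∧
        ((ℓ : ℝ) + s ≤ Real.logb 2 k →
          (n : ℝ) ≤ C * ((k : ℝ) / ((2 : ℝ) ^ ((ℓ : ℝ) / 2) * ε ^ 2)
            * √((k : ℝ) / 2 ^ (s + ℓ)))) ∧
        ∀ q : PMF (Fin k), ∃ P : DistTesting.SMPProtocol k ℓ s n,
          P.UsesOnlyFirst (min (Nat.log 2 k - ℓ) s) ∧ P.IsIdentityTest q ε (1 / 12) := by
  open DistTesting in
  have hC : (0 : ℝ) < spreadConst := by norm_num [spreadConst]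
  -- The constant is `3200004 · spreadConst` from `sampleSize_le` times `10` from
  -- `cells_mul_sqrt_le`.
  refine ⟨32000040 * spreadConst, by positivity, fun k ℓ s ε hk hℓ hε hε1 => ?_⟩
  have hk' : (0 : ℝ) < k := by exact_mod_cast hk
  obtain ⟨hSm, hab⟩ := two_pow_min_bounds (s := s) hk hℓ
  set t := min (Nat.log 2 k - ℓ) s with ht
  -- Floor plus one, here and in `g`, guarantees `2^(ℓ-1) m ≥ 2k` cells and `g 2^t ≥ spreadConst ·
  -- m` rows. None of `m`, `g`, `N` involves `q`, so one `n` serves every reference distribution.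
  set m := 2 * k / 2 ^ (ℓ - 1) + 1 with hm
  set g := spreadConst * (m / 2 ^ t + 1) with hg
  set N := ⌈2000 * √(g * ((m : ℝ) / k)) / (g * ε ^ 2 / (400 * k))⌉₊ with hN
  have hmle : (m : ℝ) ≤ 5 * max ((k : ℝ) / 2 ^ ℓ) 1 := by
    have h1 : ((2 * k / 2 ^ (ℓ - 1) : ℕ) : ℝ) ≤ (2 * k : ℕ) / (2 ^ (ℓ - 1) : ℕ) := Nat.cast_div_le
    have h2 : (2 : ℝ) ^ ℓ = 2 * 2 ^ (ℓ - 1) := by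
      rw [← pow_succ', Nat.sub_add_cancel hℓ]
    have h3 : ((2 * k : ℕ) : ℝ) / (2 ^ (ℓ - 1) : ℕ) = 4 * (k / 2 ^ ℓ) := by
      rw [h2]; push_cast; field_simp; norm_num
    rw [h3] at h1
    rw [hm]
    push_cast at h1 ⊢
    linarith [le_max_left ((k : ℝ) / 2 ^ ℓ) 1, le_max_right ((k : ℝ) / 2 ^ ℓ) 1]
  have hbound : ((2 * (g * N) : ℕ) : ℝ) ≤ 32000040 * spreadConst * (√(k : ℝ) / ε ^ 2
      * √(max ((k : ℝ) / 2 ^ ℓ) 1) * √(max ((k : ℝ) / 2 ^ (s + ℓ)) 1)) := by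
    have h1 := sampleSize_le hk (S := 2 ^ t) (by positivity) hSm hε hε1 hg hN
    have h2 := cells_mul_sqrt_le (k := k) (m := m) (S := 2 ^ t)
      (a := max ((k : ℝ) / 2 ^ ℓ) 1) (b := max ((k : ℝ) / 2 ^ (s + ℓ)) 1) (by positivity)
      (by positivity) (by positivity) hmle (by push_cast; exact hab)
    calc _ ≤ _ := h1
      _ ≤ 3200004 * spreadConst * (10 * (√(k : ℝ) * √(max ((k : ℝ) / 2 ^ ℓ) 1)
          * √(max ((k : ℝ) / 2 ^ (s + ℓ)) 1))) / ε ^ 2 := by gcongr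
      _ = _ := by ring
  refine ⟨2 * (g * N), hbound, fun hls => ?_, fun q => ?_⟩
  · have hpow : (2 : ℝ) ^ (s + ℓ) ≤ k := by
      rw [Real.le_logb_iff_rpow_le (by norm_num) hk'] at hls
      rw [← Real.rpow_natCast]
      convert hls using 2
      push_cast
      ring
    have h1 : (1 : ℝ) ≤ k / 2 ^ (s + ℓ) := by
      rwa [le_div_iff₀ (by positivity), one_mul]
    have h2 : (1 : ℝ) ≤ k / 2 ^ ℓ := by
      refine h1.trans ?_
      gcongr
      · norm_num
      · omega
    rw [max_eq_left h1, max_eq_left h2] at hbound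
    refine hbound.trans (le_of_eq ?_)
    have h3 : √((k : ℝ) / 2 ^ ℓ) = √k / (2 : ℝ) ^ ((ℓ : ℝ) / 2) := by
      rw [Real.sqrt_div hk'.le]
      congr 1
      rw [Real.sqrt_eq_rpow, ← Real.rpow_natCast, ← Real.rpow_mul (by norm_num)]
      congr 1
      ring
    rw [h3]
    have h4 : √(k : ℝ) * √k = k := Real.mul_self_sqrt hk'.le
    congr 2
    calc √(k : ℝ) / ε ^ 2 * (√k / (2 : ℝ) ^ ((ℓ : ℝ) / 2))
        = (√(k : ℝ) * √k) / ((2 : ℝ) ^ ((ℓ : ℝ) / 2) * ε ^ 2) := by field_simp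
      _ = _ := by rw [h4]
  · have hgpos : (0 : ℝ) < g := by rw [hg]; push_cast; positivity
    refine exists_identityTest hk hℓ (min_le_right _ _) hε hε1 ?_ ?_ hSm ?_ ?_ q
    · rw [hm, mul_add, mul_one, mul_comm (2 ^ (ℓ - 1))]
      exact (Nat.lt_div_mul_add (by positivity)).le
    · have : 2 * k / 2 ^ (ℓ - 1) ≤ 2 * k := Nat.div_le_self _ _
      omega
    · rw [hg, mul_assoc]
      gcongr
      rw [add_mul, one_mul]
      exact (Nat.lt_div_mul_add (by positivity)).le
    · rw [← div_le_iff₀ (by positivity)]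
      exact Nat.le_ceil _
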